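/- Let $(M,d)$ be a separable metric space (for instance a proper geodesic space) with a locally finite Borel measure $\mu$, let $1<p<\infty$, $\frac1p+\frac1q=1$, $1<N<\infty$, and let $B\subset M$ be a bounded closed set with $\mu(B)<\infty$. Let $c_p(x,y)=d(x,y)^p/p$. Let $\operatorname{Geo}(M)$ be the space of constant speed geodesics $\gamma:[0,1]\to M$ (that is, $d(\gamma_s,\gamma_t)=|t-s|\,d(\gamma_0,\gamma_1)$ for all $s,t$) with the sup distance, and put $e_t(\gamma)=\gamma_t$. For probability measures $\mu_0,\mu_1$ on $M$ let $C(\mu_0,\mu_1)$ be the infimum of $\int c_p\,d\sigma$ over all couplings $\sigma$ of $\mu_0,\mu_1$, and let $\operatorname{OptGeo}_p(\mu_0,\mu_1)$ be the set of Borel probability measures $\pi$ on $\operatorname{Geo}(M)$ such that $(e_0,e_1)_*\pi$ is a coupling of $\mu_0,\mu_1$ attaining this infimum. For a probability measure $\nu$ with Lebesgue decomposition $\nu=\rho\mu+\nu_s$ put $$\mathcal U_N(\nu)=\int U_N(\rho)\,d\mu+U_N'(\infty)\,\nu_s(M),\qquad U_N(r)=Nr\,(1-r^{-1/N}),\quad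 U_N(0)=0,\quad U_N'(\infty)=\lim_{r\to\infty}\frac{U_N(r)}{r}.$$ For $\phi:M\to[-\infty,\infty)$ put $\phi^{c_p}(y)=\inf_{x\in M}\bigl(c_p(x,y)-\phi(x)\bigr)$. A function $\phi:M\to[-\infty,\infty)$, not identically $-\infty$, is $c_p$-concave if $\phi=\psi^{c_p}$ for some $\psi:M\to[-\infty,\infty)$. A Kantorovich potential of $(\mu_0,\mu_1)$ is a $c_p$-concave function $\phi$ such that $\phi$ is $\mu_0$-integrable, $\phi^{c_p}$ is $\mu_1$-integrable and $\int\phi\,d\mu_0+\int\phi^{c_p}\,d\mu_1=C(\mu_0,\mu_1)$. The ascending slope of $\phi:M\to\mathbb R$ is $|D^+\phi|(x)=\limsup_{y\to x,\,y\ne x}\frac{[\phi(y)-\phi(x)]_+}{d(y,x)}$, read as $0$ at isolated points. Let $\mu_0,\mu_1$ be Borel probability measures on $M$ with finite $p$-th moments such that $\mu_0\ll\mu$, and suppose that there is some $\pi\in\operatorname{OptGeo}_p(\mu_0,\mu_1)$ such that, with $\mu_t=(e_t)_*\pi$, $$\lim_{t\downarrow0}\mathcal U_N(\mu_t)=\mathcal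 U_N(\mu_0)\qquad\text{and}\qquad \operatorname{supp}\mu_t\subset B\quad\text{for all }t\in[0,1].$$ Let $\phi:M\to\mathbb R$ be a Kantorovich potential of $(\mu_0,\mu_1)$ that is Lipschitz on every bounded subset of $M$. Then for every $\tilde\pi\in\operatorname{OptGeo}_p(\mu_0,\mu_1)$ $$d(\gamma_0,\gamma_1)^p=\bigl(|D^+\phi|(\gamma_0)\bigr)^q\qquad\text{for }\tilde\pi\text{-a.e. }\gamma .$$ -/

import Mathlib

open MeasureTheory Filter Topology
open scoped ENNReal NNReal

noncomputable section

namespace MetricBrenier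

/-! ### Slopes -/

/-- The ascending slope `|D⁺f|(x) = limsup_{y → x, y ≠ x} [f y - f x]₊ / d(y, x)`,
as an element of `[0, ∞]`. -/
def ascendingSlope {M : Type*} [MetricSpace M] (f : M → ℝ) (x : M) : ℝ≥0∞ :=
  limsup (fun y => ENNReal.ofReal (f y - f x) / edist y x) (𝓝[≠] x)

/-! ### Constant speed geodesics -/

/-- The space of constant speed geodesics `γ : [0,1] → M`. -/
def Geo (M : Type*) [MetricSpace M] : Type _ :=
  {γ : C(unitInterval, M) //
    ∀ s t : unitInterval, dist (γ s) (γ t) = |(t : ℝ) - s| * dist (γ 0) (γ 1)}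

/-- The sup distance on the space of geodesics. -/
instance {M : Type*} [MetricSpace M] : MetricSpace (Geo M) :=
  inferInstanceAs (MetricSpace {γ : C(unitInterval, M) //
    ∀ s t : unitInterval, dist (γ s) (γ t) = |(t : ℝ) - s| * dist (γ 0) (γ 1)})

/-- The space of geodesics carries its Borel sigma-algebra. -/
instance {M : Type*} [MetricSpace M] : MeasurableSpace (Geo M) := borel _

instance {M : Type*} [MetricSpace M] : BorelSpace (Geo M) := ⟨rfl⟩

/-- The evaluation map `e_t γ = γ_t`. -/
def Geo.eval {M : Type*} [MetricSpace M] (t : unitInterval) (γ : Geo M) : M := γ.1 t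

theorem Geo.continuous_eval {M : Type*} [MetricSpace M] (t : unitInterval) :
    Continuous (Geo.eval t : Geo M → M) :=
  (continuous_eval_const t).comp continuous_subtype_val

/-! ### The transport problem for the cost `d ^ p / p` -/

/-- The cost `c_p(x, y) = d(x, y) ^ p / p`. -/
def cost {M : Type*} [MetricSpace M] (p : ℝ) (x y : M) : ℝ := dist x y ^ p / p

/-- `ν` has a finite `p`-th moment. -/
def FiniteMoment {M : Type*} [MetricSpace M] [MeasurableSpace M] (p : ℝ) (ν : Measure M) : Prop :=
  ∃ x₀ : M, ∫⁻ x, edist x x₀ ^ p ∂ν < ∞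

/-- `σ` is a coupling of `ν₀` and `ν₁`. -/
def IsCoupling {M : Type*} [MeasurableSpace M] (ν₀ ν₁ : Measure M) (σ : Measure (M × M)) : Prop :=
  σ.map Prod.fst = ν₀ ∧ σ.map Prod.snd = ν₁

/-- The total cost of a plan. -/
def planCost {M : Type*} [MetricSpace M] [MeasurableSpace M] (p : ℝ) (σ : Measure (M × M)) :
    ℝ≥0∞ :=
  ∫⁻ z, ENNReal.ofReal (cost p z.1 z.2) ∂σ

/-- The optimal transport cost, that is `w_p(ν₀, ν₁) ^ p`. -/
def transportCost {M : Type*} [MetricSpace M] [MeasurableSpace M] (p : ℝ) (ν₀ ν₁ : Measure M) :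
    ℝ≥0∞ :=
  ⨅ (σ : Measure (M × M)) (_ : IsCoupling ν₀ ν₁ σ), planCost p σ

/-- `σ` is an optimal coupling of `ν₀` and `ν₁`. -/
def IsOptimalCoupling {M : Type*} [MetricSpace M] [MeasurableSpace M] (p : ℝ)
    (ν₀ ν₁ : Measure M) (σ : Measure (M × M)) : Prop :=
  IsCoupling ν₀ ν₁ σ ∧ planCost p σ = transportCost p ν₀ ν₁

/-- The set of optimal geodesic plans: the probability measures `Π` on the space of geodesics
such that `(e₀, e₁)_* Π` is an optimal coupling of `ν₀` and `ν₁`. -/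
def OptGeo {M : Type*} [MetricSpace M] [MeasurableSpace M] (p : ℝ) (ν₀ ν₁ : Measure M) :
    Set (Measure (Geo M)) :=
  {Q | IsProbabilityMeasure Q ∧
    IsOptimalCoupling p ν₀ ν₁ (Q.map fun γ => (Geo.eval 0 γ, Geo.eval 1 γ))}

/-! ### Kantorovich potentials -/

/-- The `c_p`-transform `φ^c(y) = inf_x (c_p(x, y) - φ(x))` of a function with values in
`[-∞, ∞)`; since `c_p` is symmetric it is also the `c̄_p`-transform. -/
def cTransform {M : Type*} [MetricSpace M] (p : ℝ) (φ : M → EReal) (y : M) : EReal :=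
  ⨅ x : M, ((cost p x y : ℝ) : EReal) - φ x

/-- A proper function `φ : M → [-∞, ∞)` is `c_p`-concave if it is the transform of some function
`ψ : M → [-∞, ∞)`. -/
def IsCConcave {M : Type*} [MetricSpace M] (p : ℝ) (φ : M → EReal) : Prop :=
  (∀ x, φ x ≠ ⊤) ∧ (∃ x, φ x ≠ ⊥) ∧
    ∃ ψ : M → EReal, (∀ y, ψ y ≠ ⊤) ∧ φ = cTransform p ψ

/-- `f` is `ν`-almost everywhere finite and its real part is `ν`-integrable. -/
def EIntegrable {M : Type*} [MeasurableSpace M] (f : M → EReal) (ν : Measure M) : Prop :=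
  (∀ᵐ x ∂ν, f x ≠ ⊤ ∧ f x ≠ ⊥) ∧ Integrable (fun x => (f x).toReal) ν

/-- A Kantorovich potential of `(ν₀, ν₁)` is a `c_p`-concave function `φ` such that the pair
`(φ, φ^c)` attains the dual problem, i.e. `∫ φ dν₀ + ∫ φ^c dν₁` is the optimal transport cost. -/
def IsKantorovichPotential {M : Type*} [MetricSpace M] [MeasurableSpace M] (p : ℝ)
    (ν₀ ν₁ : Measure M) (φ : M → EReal) : Prop :=
  IsCConcave p φ ∧ EIntegrable φ ν₀ ∧ EIntegrable (cTransform p φ) ν₁ ∧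
    ((∫ x, (φ x).toReal ∂ν₀ + ∫ y, (cTransform p φ y).toReal ∂ν₁ : ℝ) : EReal) =
      (transportCost p ν₀ ν₁ : EReal)

/-! ### The internal energy functionals -/

/-- `U'(∞) = lim_{r → ∞} U(r) / r` (the limit exists for convex `U` with `U(0) = 0`). -/
def slopeAtInfinity (U : ℝ → ℝ) : EReal :=
  limsup (fun r : ℝ => ((U r / r : ℝ) : EReal)) atTop

/-- The functional `∫ U(ρ) dμ + U'(∞) ν_s(M)`, where `ν = ρ μ + ν_s` is the Lebesgue decomposition
of `ν` with respect to `μ`; the integral is the one of the positive part minus the one of the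
negative part. -/
def energy {M : Type*} [MeasurableSpace M] (U : ℝ → ℝ) (μ ν : Measure M) : EReal :=
  ((∫⁻ x, ENNReal.ofReal (U (ν.rnDeriv μ x).toReal) ∂μ : ℝ≥0∞) : EReal)
    - ((∫⁻ x, ENNReal.ofReal (-U (ν.rnDeriv μ x).toReal) ∂μ : ℝ≥0∞) : EReal)
    + slopeAtInfinity U * ((ν.singularPart μ Set.univ : ℝ≥0∞) : EReal)

/-- The function `U_N(r) = N r (1 - r ^ (-1/N))`. -/
def powerDensity (N r : ℝ) : ℝ := N * r * (1 - r ^ (-1 / N))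

/-- The functional generated by `U_N`. -/
def energyN {M : Type*} [MeasurableSpace M] (N : ℝ) (μ ν : Measure M) : EReal :=
  energy (powerDensity N) μ ν

end MetricBrenier

end

/-!
Write `D = d(γ₀, γ₁)`. The argument compares two integrals, `∫ D ^ p` over an optimal geodesic plan
and `∫ |D⁺φ| ^ q dμ₀`.

*Upper bound for the slope.* Duality forces every optimal coupling onto the superdifferential of
`φ` (`IsOptimalCoupling.ae_memSuperdiff`): for almost every `γ` the function `c_p(·, γ₁) - φ` is
minimal at `γ₀`. The triangle inequality then gives `|D⁺φ|(γ₀) ≤ D ^ (p - 1)`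
(`MemSuperdiff.ascendingSlope_le`), that is `|D⁺φ| ^ q ≤ D ^ p`.

*Lower bound for its integral.* Minimality at `γ₀` also says that `φ` drops along `γ` by at least
`t (1 - t) ^ (p - 1) D ^ p` up to time `t`. Seen from `γ_t`, this is an ascent over the distance
`t D`, hence bounded by `t D` times the slope `L_r` of `φ` at a scale `r > t D`
(`MemSuperdiff.mul_edist_rpow_le`). Working at a positive scale makes any integration along the
geodesic unnecessary. By Hölder, `(1 - t) ^ p ∫ D ^ p ≤ ∫ L_r ^ q dμ_t`. Letting `t → 0` and then
`r → 0` yields `∫ D ^ p ≤ ∫ |D⁺φ| ^ q dμ₀`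
(`lintegral_edist_rpow_le_lintegral_ascendingSlope`).

*The limit `t → 0`.* The function `L_r` is only lower semicontinuous, for which weak convergence
of `μ_t` gives the wrong inequality; this is where the energy enters. On measures carried by
`B` the energy is `N - N ∫_B ρ ^ (1 - 1/N)`
(`energyN_eq`). The concave functional `∫_B ρ ^ (1 - 1/N)` is an infimum of integrals of continuous
functions, so it is weakly upper semicontinuous. Applied to midpoints of `ρ_t` and `ρ_0`, this and
strict concavity give almost everywhere convergence of densities along a sequence of times, and
Fatou's lemma gives `limsup ∫ g dμ_t ≤ ∫ g dμ₀` for bounded Borel `g`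
(`exists_subseq_limsup_lintegral_le`).

Both bounds together give almost everywhere equality for the given plan. Since `∫ D ^ p` is `p`
times the transport cost for every optimal geodesic plan, the same comparison applies to all of
them.
-/

noncomputable section

namespace MetricBrenier

open scoped BoundedContinuousFunction

/-! ### Strict concavity of powers -/

/-- Weighted arithmetic-geometric mean inequality, read as the tangent line inequality for the
concave function `r ↦ r ^ α` at the point `w`. -/
theorem rpow_le_tangent {α r w : ℝ} (hα0 : 0 ≤ α) (hα1 : α ≤ 1) (hr : 0 ≤ r) (hw : 0 < w) :
    r ^ α ≤ α * w ^ (α - 1) * r + (1 - α) * w ^ α := by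
  have h := Real.geom_mean_le_arith_mean2_weighted hα0 (sub_nonneg.2 hα1) hr hw.le (by ring)
  have hw' : (0 : ℝ) < w ^ (α - 1) := Real.rpow_pos_of_pos hw _
  have h1 : w ^ (1 - α) * w ^ (α - 1) = 1 := by
    rw [← Real.rpow_add hw]; simp
  have h2 : w * w ^ (α - 1) = w ^ α := by
    rw [Real.rpow_sub_one hw.ne']; field_simp
  calc r ^ α = r ^ α * w ^ (1 - α) * w ^ (α - 1) := by rw [mul_assoc, h1, mul_one]
    _ ≤ (α * r + (1 - α) * w) * w ^ (α - 1) := by gcongr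
    _ = α * w ^ (α - 1) * r + (1 - α) * (w * w ^ (α - 1)) := by ring
    _ = _ := by rw [h2]

theorem rpow_combination_le {α a b r s : ℝ} (hα0 : 0 ≤ α) (hα1 : α ≤ 1) (hr : 0 ≤ r)
    (hs : 0 ≤ s) (ha : 0 ≤ a) (hb : 0 ≤ b) (hab : a + b = 1) :
    a * r ^ α + b * s ^ α ≤ (a * r + b * s) ^ α :=
  (Real.concaveOn_rpow hα0 hα1).2 (Set.mem_Ici.2 hr) (Set.mem_Ici.2 hs) ha hb hab

/-- The midpoint deficit of the concave function `r ↦ r ^ α`. -/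
def midDeficit (α r s : ℝ) : ℝ := ((r + s) / 2) ^ α - (r ^ α + s ^ α) / 2

theorem midDeficit_nonneg {α r s : ℝ} (hα0 : 0 ≤ α) (hα1 : α ≤ 1) (hr : 0 ≤ r) (hs : 0 ≤ s) :
    0 ≤ midDeficit α r s := by
  have h := rpow_combination_le hα0 hα1 hr hs (a := 1 / 2) (b := 1 / 2)
    (by norm_num) (by norm_num) (by norm_num)
  rw [show 1 / 2 * r + 1 / 2 * s = (r + s) / 2 by ring] at h
  unfold midDeficit
  linarith

theorem midDeficit_pos {α r s : ℝ} (hα0 : 0 < α) (hα1 : α < 1) (hr : 0 ≤ r) (hs : 0 ≤ s)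
    (h : r ≠ s) : 0 < midDeficit α r s := by
  have h := (Real.strictConcaveOn_rpow hα0 hα1).2 (Set.mem_Ici.2 hr) (Set.mem_Ici.2 hs) h
    (show (0 : ℝ) < 1 / 2 by norm_num) (show (0 : ℝ) < 1 / 2 by norm_num) (by norm_num)
  simp only [smul_eq_mul] at h
  rw [show 1 / 2 * r + 1 / 2 * s = (r + s) / 2 by ring] at h
  unfold midDeficit
  linarith

/-- The midpoint deficit grows when one of the two points moves away from the other. -/
theorem midDeficit_le_of_segment {α r s θ : ℝ} (hα0 : 0 ≤ α) (hα1 : α ≤ 1) (hr : 0 ≤ r)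
    (hs : 0 ≤ s) (hθ0 : 0 ≤ θ) (hθ1 : θ ≤ 1) :
    midDeficit α (s + θ * (r - s)) s ≤ midDeficit α r s := by
  set u := s + θ * (r - s) with hu
  have hu0 : 0 ≤ u := by
    have : u = (1 - θ) * s + θ * r := by rw [hu]; ring
    rw [this]; nlinarith [mul_nonneg (sub_nonneg.2 hθ1) hs, mul_nonneg hθ0 hr]
  have hv0 : 0 ≤ (u + s) / 2 := by positivity
  have hd : 0 < 2 - θ := by linarith
  -- both `(r + s) / 2` and `u` lie on the segment from `(u + s) / 2` to `r`
  have h1 := rpow_combination_le hα0 hα1 hv0 hr (a := 1 / (2 - θ))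
    (b := (1 - θ) / (2 - θ)) (by positivity) (div_nonneg (by linarith) hd.le)
    (by field_simp; ring)
  have h2 := rpow_combination_le hα0 hα1 hv0 hr (a := (2 - 2 * θ) / (2 - θ))
    (b := θ / (2 - θ)) (div_nonneg (by linarith) hd.le) (by positivity)
    (by field_simp; ring)
  rw [show 1 / (2 - θ) * ((u + s) / 2) + (1 - θ) / (2 - θ) * r = (r + s) / 2 by
    rw [hu]; field_simp; ring] at h1
  rw [show (2 - 2 * θ) / (2 - θ) * ((u + s) / 2) + θ / (2 - θ) * r = u by
    rw [hu]; field_simp; ring] at h2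
  unfold midDeficit
  have key : 1 / (2 - θ) * ((u + s) / 2) ^ α + (1 - θ) / (2 - θ) * r ^ α
      + ((2 - 2 * θ) / (2 - θ) * ((u + s) / 2) ^ α + θ / (2 - θ) * r ^ α) / 2
      = ((u + s) / 2) ^ α + r ^ α / 2 := by
    field_simp; ring
  linarith

theorem tendsto_of_midDeficit_tendsto_zero {α s : ℝ} {r : ℕ → ℝ} (hα0 : 0 < α) (hα1 : α < 1)
    (hr : ∀ n, 0 ≤ r n) (hs : 0 ≤ s)
    (h : Tendsto (fun n => midDeficit α (r n) s) atTop (𝓝 0)) : Tendsto r atTop (𝓝 s) := by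
  rw [Metric.tendsto_atTop']
  intro ε hε
  have key : ∃ δ > 0, ∀ x, 0 ≤ x → ε ≤ |x - s| → δ ≤ midDeficit α x s := by
    have hup : 0 < midDeficit α (s + ε) s :=
      midDeficit_pos hα0 hα1 (by positivity) hs (by linarith)
    have hupx : ∀ x, 0 ≤ x → s + ε ≤ x → midDeficit α (s + ε) s ≤ midDeficit α x s := by
      intro x hx hxs
      have h0 : 0 < x - s := by linarith
      have := midDeficit_le_of_segment (θ := ε / (x - s)) hα0.le hα1.le hx hs (by positivity)
        ((div_le_one h0).2 (by linarith))
      rwa [div_mul_cancel₀ _ h0.ne'] at this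
    by_cases hsε : ε ≤ s
    · have hlo : 0 < midDeficit α (s - ε) s :=
        midDeficit_pos hα0 hα1 (by linarith) hs (by linarith)
      refine ⟨min (midDeficit α (s + ε) s) (midDeficit α (s - ε) s), lt_min hup hlo, ?_⟩
      intro x hx hxs
      rcases le_abs.1 hxs with h1 | h1
      · exact (min_le_left _ _).trans (hupx x hx (by linarith))
      · refine (min_le_right _ _).trans ?_
        have h0 : 0 < s - x := by linarith
        have := midDeficit_le_of_segment (θ := ε / (s - x)) hα0.le hα1.le hx hs (by positivity)
          ((div_le_one h0).2 (by linarith))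
        rwa [show s + ε / (s - x) * (x - s) = s - ε by field_simp; ring] at this
    · refine ⟨_, hup, fun x hx hxs => hupx x hx ?_⟩
      rcases le_abs.1 hxs with h1 | h1 <;> linarith
  obtain ⟨δ, hδ, hk⟩ := key
  obtain ⟨n₀, hn₀⟩ := Metric.tendsto_atTop'.1 h δ hδ
  refine ⟨n₀, fun n hn => ?_⟩
  by_contra hcon
  have h1 := hk (r n) (hr n) (by rw [Real.dist_eq] at hcon; linarith)
  have h2 := hn₀ n hn
  rw [Real.dist_eq, sub_zero] at h2
  linarith [le_abs_self (midDeficit α (r n) s)]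

/-! ### Ascending slopes at a positive scale -/

section ScaleSlope

variable {M : Type*} [MetricSpace M]

/-- The ascending slope of `f` at scale `r`: the supremum of `[f y - f x]₊ / d(y, x)` over
`0 < d(y, x) < r`. -/
def scaleSlope (f : M → ℝ) (r : ℝ) (x : M) : ℝ≥0∞ :=
  ⨆ y : {y : M // y ≠ x ∧ dist y x < r}, ENNReal.ofReal (f y - f x) / edist (y : M) x

theorem ofReal_sub_le_scaleSlope_mul {f : M → ℝ} {r : ℝ} {x y : M} (h : dist y x < r) :
    ENNReal.ofReal (f y - f x) ≤ scaleSlope f r x * edist y x := by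
  by_cases hyx : y = x
  · simp [hyx]
  · rw [← ENNReal.div_le_iff (by simpa using hyx) (edist_ne_top _ _)]
    exact le_iSup (fun y : {y : M // y ≠ x ∧ dist y x < r} =>
      ENNReal.ofReal (f y - f x) / edist (y : M) x) ⟨y, hyx, h⟩

theorem scaleSlope_mono (f : M → ℝ) {r s : ℝ} (hrs : r ≤ s) (x : M) :
    scaleSlope f r x ≤ scaleSlope f s x :=
  iSup_le fun y => le_iSup (fun y : {y : M // y ≠ x ∧ dist y x < s} =>
      ENNReal.ofReal (f y - f x) / edist (y : M) x) ⟨y, y.2.1, y.2.2.trans_le hrs⟩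

/-- The slope at a fixed scale is a supremum of difference quotients over an open condition,
hence lower semicontinuous. -/
theorem lowerSemicontinuous_scaleSlope {f : M → ℝ} (hf : Continuous f) (r : ℝ) :
    LowerSemicontinuous (scaleSlope f r) := by
  intro x a ha
  obtain ⟨⟨y, hyx, hyr⟩, hy⟩ := lt_iSup_iff.1 ha
  have hcont : ContinuousAt (fun z => ENNReal.ofReal (f y - f z) / edist y z) x := by
    refine ENNReal.Tendsto.div ?_ (Or.inr (by simpa using hyx)) ?_ (Or.inl ?_)
    · exact (ENNReal.continuous_ofReal.comp (continuous_const.sub hf)).continuousAt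
    · exact (continuous_const.edist continuous_id).continuousAt
    · exact edist_ne_top _ _
  have h1 : ∀ᶠ z in 𝓝 x, a < ENNReal.ofReal (f y - f z) / edist y z :=
    hcont.eventually (lt_mem_nhds hy)
  have h2 : ∀ᶠ z in 𝓝 x, y ≠ z := (eventually_ne_nhds hyx.symm).mono fun z hz => hz.symm
  have h3 : ∀ᶠ z in 𝓝 x, dist y z < r :=
    (continuous_const.dist continuous_id).continuousAt.eventually (gt_mem_nhds hyr)
  filter_upwards [h1, h2, h3] with z hz1 hz2 hz3
  exact hz1.trans_le (le_iSup (fun y : {y : M // y ≠ z ∧ dist y z < r} =>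
      ENNReal.ofReal (f y - f z) / edist (y : M) z) ⟨y, hz2, hz3⟩)

theorem ascendingSlope_eq_iInf_scaleSlope (f : M → ℝ) (x : M) :
    ascendingSlope f x = ⨅ n : ℕ, scaleSlope f (1 / ((n : ℝ) + 1)) x := by
  have hb : (𝓝[≠] x).HasBasis (fun _ : ℕ => True)
      fun n => Metric.ball x (1 / ((n : ℝ) + 1)) ∩ {x}ᶜ :=
    nhdsWithin_hasBasis Metric.nhds_basis_ball_inv_nat_succ _
  rw [ascendingSlope, hb.limsup_eq_iInf_iSup]
  simp only [iInf_true]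
  refine iInf_congr fun n => le_antisymm ?_ ?_
  · refine iSup₂_le fun y hy => le_iSup (fun y : {y : M // y ≠ x ∧ dist y x < 1 / ((n : ℝ) + 1)} =>
      ENNReal.ofReal (f y - f x) / edist (y : M) x) ⟨y, hy.2, hy.1⟩
  · exact iSup_le fun y => le_iSup₂ (f := fun y (_ : y ∈ Metric.ball x (1 / ((n : ℝ) + 1)) ∩ {x}ᶜ)
      => ENNReal.ofReal (f y - f x) / edist y x) (y : M) ⟨y.2.2, y.2.1⟩

theorem measurable_ascendingSlope [MeasurableSpace M] [BorelSpace M] {f : M → ℝ}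
    (hf : Continuous f) : Measurable (ascendingSlope f) := by
  have : ascendingSlope f = fun x => ⨅ n : ℕ, scaleSlope f (1 / ((n : ℝ) + 1)) x :=
    funext (ascendingSlope_eq_iInf_scaleSlope f)
  rw [this]
  exact .iInf fun n => (lowerSemicontinuous_scaleSlope hf _).measurable

theorem scaleSlope_le_of_lipschitzOnWith {f : M → ℝ} {K : ℝ≥0} {S : Set M}
    (hf : LipschitzOnWith K f S) {x : M} {r : ℝ} (hr : 0 < r) (hx : Metric.ball x r ⊆ S) :
    scaleSlope f r x ≤ K := by
  refine iSup_le fun ⟨y, hyx, hyr⟩ => ?_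
  refine ENNReal.div_le_of_le_mul ?_
  refine le_trans ?_ (hf (hx hyr) (hx (Metric.mem_ball_self hr)))
  rw [edist_dist, Real.dist_eq]
  exact ENNReal.ofReal_le_ofReal (le_abs_self _)

end ScaleSlope

/-! ### Convexity of the cost -/

theorem rpow_sub_rpow_le {p a b : ℝ} (hp : 1 ≤ p) (ha : 0 ≤ a) (hb : 0 < b) :
    (b ^ p - a ^ p) / p ≤ (b - a) * b ^ (p - 1) := by
  have hp0 : 0 < p := by linarith
  have h := one_add_mul_self_le_rpow_one_add (s := a / b - 1)
    (by have : 0 ≤ a / b := by positivity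
        linarith) hp
  rw [show 1 + (a / b - 1) = a / b by ring, Real.div_rpow ha hb.le] at h
  have hbp : 0 < b ^ p := Real.rpow_pos_of_pos hb p
  rw [le_div_iff₀ hbp] at h
  rw [Real.rpow_sub_one hb.ne', div_le_iff₀ hp0]
  have : (b - a) * (b ^ p / b) * p = - (p * (a / b - 1)) * b ^ p := by field_simp; ring
  rw [this]
  linarith

theorem le_rpow_sub_rpow {p a b : ℝ} (hp : 1 ≤ p) (ha : 0 < a) (hb : 0 ≤ b) :
    (b - a) * a ^ (p - 1) ≤ (b ^ p - a ^ p) / p := by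
  have h := rpow_sub_rpow_le hp hb ha
  have : (b ^ p - a ^ p) / p = -((a ^ p - b ^ p) / p) := by ring
  rw [this]
  linarith

/-! ### Strong convergence from weak convergence and convergence of a concave functional -/

theorem rpow_le_one_add {α r : ℝ} (hα0 : 0 ≤ α) (hα1 : α ≤ 1) (hr : 0 ≤ r) : r ^ α ≤ 1 + r := by
  rcases le_total r 1 with h | h
  · linarith [Real.rpow_le_one hr h hα0]
  · have := Real.rpow_le_rpow_of_exponent_le h hα1
    rw [Real.rpow_one] at this
    linarith

theorem continuous_rpow_of_le {X : Type*} [TopologicalSpace X] {w : X → ℝ}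
    (hw : Continuous w) {δ : ℝ} (hδ : 0 < δ)
    (h : ∀ x, δ ≤ w x) (a : ℝ) : Continuous fun x => w x ^ a :=
  hw.rpow_const fun x => Or.inl (hδ.trans_le (h x)).ne'

theorem integral_mul_le_integral_of_withDensity_le {X : Type*} [MeasurableSpace X]
    {m ν : Measure X} {r f : X → ℝ}
    (hr : Measurable r) (hr0 : ∀ x, 0 ≤ r x) (hle : m.withDensity (fun x => .ofReal (r x)) ≤ ν)
    (hf0 : ∀ x, 0 ≤ f x) (hf : Integrable f ν) : ∫ x, f x * r x ∂m ≤ ∫ x, f x ∂ν := by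
  have h := integral_mono_measure hle (ae_of_all _ hf0) hf
  rw [integral_withDensity_eq_integral_toReal_smul hr.ennreal_ofReal
    (ae_of_all _ fun x => ENNReal.ofReal_lt_top)] at h
  simpa [ENNReal.toReal_ofReal (hr0 _), mul_comm] using h

theorem integrable_rpow_of_le_one {X : Type*} [MeasurableSpace X] {m : Measure X}
    [IsFiniteMeasure m] {α : ℝ} (hα0 : 0 ≤ α)
    (hα1 : α ≤ 1) {r : X → ℝ} (hr0 : ∀ x, 0 ≤ r x) (hr : Integrable r m) :
    Integrable (fun x => r x ^ α) m := by
  refine ((integrable_const (1 : ℝ)).add hr).mono'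
    (hr.1.aemeasurable.pow_const _).aestronglyMeasurable (ae_of_all _ fun x => ?_)
  rw [Real.norm_of_nonneg (Real.rpow_nonneg (hr0 x) _)]
  exact rpow_le_one_add hα0 hα1 (hr0 x)

section StrongConvergence

variable {M : Type*} [MetricSpace M] [MeasurableSpace M] [BorelSpace M]

theorem exists_boundedContinuous_tendsto_ae {m : Measure M}
    [IsFiniteMeasure m] {f : M → ℝ} (hf : Integrable f m) :
    ∃ g : ℕ → M →ᵇ ℝ, ∀ᵐ x ∂m, Tendsto (fun n => g n x) atTop (𝓝 (f x)) := by
  have h : ∀ n : ℕ, ∃ g : M →ᵇ ℝ, eLpNorm (f - (g : M → ℝ)) 1 m ≤ ((n : ℝ≥0∞) + 1)⁻¹ ∧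
      MemLp g 1 m :=
    fun n => (memLp_one_iff_integrable.2 hf).exists_boundedContinuous_eLpNorm_sub_le
      ENNReal.one_ne_top (by simp)
  choose g hg hgm using h
  have hlim : Tendsto (fun n => eLpNorm (⇑(g n) - f) 1 m) atTop (𝓝 0) := by
    refine tendsto_of_tendsto_of_tendsto_of_le_of_le tendsto_const_nhds
      (h := fun n : ℕ => ((n : ℝ≥0∞) + 1)⁻¹) ?_ (fun _ => zero_le)
      (fun n => by rw [eLpNorm_sub_comm]; exact hg n)
    have := (tendsto_add_atTop_iff_nat 1).2 ENNReal.tendsto_inv_nat_nhds_zero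
    simpa using this
  obtain ⟨k, -, hk⟩ := (tendstoInMeasure_of_tendsto_eLpNorm one_ne_zero
    (fun n => (hgm n).1) hf.1 hlim).exists_seq_tendsto_ae
  exact ⟨fun n => g (k n), hk⟩

/-- The tangent line of `r ↦ r ^ α` at the point `w`, evaluated at `r`. -/
def rpowTangent (α w r : ℝ) : ℝ := α * w ^ (α - 1) * r + (1 - α) * w ^ α

/-- Truncation to the interval `[1 / (k + 1), k + 1]`. -/
def clampNat (k : ℕ) (y : ℝ) : ℝ := max (1 / ((k : ℝ) + 1)) (min (k + 1) y)

theorem clampNat_lower (k : ℕ) (y : ℝ) : 1 / ((k : ℝ) + 1) ≤ clampNat k y := le_max_left _ _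

theorem clampNat_pos (k : ℕ) (y : ℝ) : 0 < clampNat k y :=
  lt_of_lt_of_le (by positivity) (clampNat_lower k y)

theorem clampNat_upper (k : ℕ) (y : ℝ) : clampNat k y ≤ k + 1 := by
  refine max_le ?_ (min_le_left _ _)
  rw [div_le_iff₀ (by positivity)]
  nlinarith [(Nat.cast_nonneg k : (0 : ℝ) ≤ k)]

theorem continuous_clampNat (k : ℕ) : Continuous (clampNat k) :=
  continuous_const.max (continuous_const.min continuous_id)

theorem tendsto_clampNat {y : ℝ} (hy : 0 ≤ y) :
    Tendsto (fun k => clampNat k y) atTop (𝓝 y) := by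
  have h1 : Tendsto (fun k : ℕ => 1 / ((k : ℝ) + 1)) atTop (𝓝 0) :=
    tendsto_one_div_add_atTop_nhds_zero_nat
  have h2 : Tendsto (fun k : ℕ => min ((k : ℝ) + 1) y) atTop (𝓝 y) := by
    refine tendsto_const_nhds.congr' ?_
    filter_upwards [eventually_ge_atTop ⌈y⌉₊] with k hk
    have : y ≤ k := (Nat.le_ceil y).trans (by exact_mod_cast hk)
    rw [min_eq_right (by linarith)]
  have := h1.max h2
  rwa [max_eq_right hy] at this

theorem rpowTangent_nonneg {α w r : ℝ} (hα0 : 0 ≤ α) (hα1 : α ≤ 1) (hw : 0 < w) (hr : 0 ≤ r) :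
    0 ≤ rpowTangent α w r :=
  add_nonneg (mul_nonneg (mul_nonneg hα0 (Real.rpow_nonneg hw.le _)) hr)
    (mul_nonneg (sub_nonneg.2 hα1) (Real.rpow_nonneg hw.le _))

theorem rpow_sub_one_le_of_le {α δ w : ℝ} (hα1 : α ≤ 1) (hδ : 0 < δ) (hw : δ ≤ w) :
    w ^ (α - 1) ≤ δ ^ (α - 1) :=
  Real.rpow_le_rpow_of_nonpos hδ hw (by linarith)

theorem rpowTangent_le {α δ K w r : ℝ} (hα0 : 0 ≤ α) (hα1 : α ≤ 1) (hδ : 0 < δ) (hw : δ ≤ w)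
    (hwK : w ≤ K) (hr : 0 ≤ r) : rpowTangent α w r ≤ δ ^ (α - 1) * r + (1 + K) := by
  have hw0 : 0 < w := hδ.trans_le hw
  have h1 := rpow_sub_one_le_of_le hα1 hδ hw
  have h2 := rpow_le_one_add hα0 hα1 hw0.le
  have h3 : α * w ^ (α - 1) ≤ 1 * δ ^ (α - 1) :=
    mul_le_mul hα1 h1 (Real.rpow_nonneg hw0.le _) zero_le_one
  have h4 : (1 - α) * w ^ α ≤ 1 * (1 + K) :=
    mul_le_mul (by linarith) (by linarith) (Real.rpow_nonneg hw0.le _) zero_le_one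
  unfold rpowTangent
  nlinarith [mul_le_mul_of_nonneg_right h3 hr]

theorem rpowTangent_clampNat_le {α r : ℝ} (hα0 : 0 ≤ α) (hα1 : α ≤ 1) (hr : 0 ≤ r) (k : ℕ) :
    rpowTangent α (clampNat k r) r ≤ 2 + 2 * r := by
  have hk : (0 : ℝ) < (k : ℝ) + 1 := by positivity
  set w := clampNat k r with hw
  have hw0 : 0 < w := clampNat_pos k r
  have hwr : w ≤ 1 + r := by
    refine max_le ?_ ((min_le_right _ _).trans (by linarith))
    have : 1 / ((k : ℝ) + 1) ≤ 1 := by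
      rw [div_le_one hk]; linarith [(Nat.cast_nonneg k : (0 : ℝ) ≤ k)]
    linarith
  have h2 : (1 - α) * w ^ α ≤ (1 - α) * (2 + r) :=
    mul_le_mul_of_nonneg_left ((rpow_le_one_add hα0 hα1 hw0.le).trans (by linarith)) (by linarith)
  have h1 : w ^ (α - 1) * r ≤ 2 + 2 * r := by
    rcases le_total r w with h | h
    · calc w ^ (α - 1) * r ≤ w ^ (α - 1) * w := by gcongr
        _ = w ^ α := by rw [Real.rpow_sub_one hw0.ne']; field_simp
        _ ≤ 1 + w := rpow_le_one_add hα0 hα1 hw0.le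
        _ ≤ 2 + 2 * r := by linarith
    · rcases le_total r ((k : ℝ) + 1) with h' | h'
      · have : w = r := le_antisymm h
          (by rw [hw, clampNat, min_eq_right h']; exact le_max_right _ _)
        rw [this, Real.rpow_sub_one (this ▸ hw0.ne'), div_mul_cancel₀ _ (this ▸ hw0.ne')]
        linarith [rpow_le_one_add hα0 hα1 hr]
      · have h1w : 1 ≤ w := by
          rw [hw, clampNat, min_eq_left h']
          exact le_trans (by linarith [(Nat.cast_nonneg k : (0 : ℝ) ≤ k)]) (le_max_right _ _)
        have := Real.rpow_le_one_of_one_le_of_nonpos h1w (by linarith : α - 1 ≤ 0)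
        nlinarith
  unfold rpowTangent
  have h3 : α * w ^ (α - 1) * r ≤ α * (2 + 2 * r) := by
    rw [mul_assoc]; exact mul_le_mul_of_nonneg_left h1 hα0
  nlinarith

theorem tendsto_rpowTangent_clampNat {α r : ℝ} (hα0 : 0 < α) (hr : 0 ≤ r) :
    Tendsto (fun k => rpowTangent α (clampNat k r) r) atTop (𝓝 (r ^ α)) := by
  have h := tendsto_clampNat hr
  have h2 : Tendsto (fun k => (1 - α) * clampNat k r ^ α) atTop (𝓝 ((1 - α) * r ^ α)) :=
    (h.rpow_const (Or.inr hα0.le)).const_mul _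
  rcases hr.eq_or_lt with rfl | hr0
  · rw [Real.zero_rpow hα0.ne'] at h2 ⊢
    simpa [rpowTangent] using h2
  · have h1 : Tendsto (fun k => α * clampNat k r ^ (α - 1) * r) atTop
        (𝓝 (α * r ^ (α - 1) * r)) :=
      ((h.rpow_const (Or.inl hr0.ne')).const_mul _).mul_const _
    have := h1.add h2
    rwa [show α * r ^ (α - 1) * r + (1 - α) * r ^ α = r ^ α by
      rw [Real.rpow_sub_one hr0.ne']; field_simp; ring] at this

/-- The power functional `∫ r ^ α` is the infimum of the affine functionals `∫ rpowTangent α w r`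
over *continuous* `w` bounded away from zero and infinity. This is what makes it upper
semicontinuous for weak convergence. -/
theorem exists_continuous_integral_rpowTangent_lt {m : Measure M} [IsFiniteMeasure m] {α : ℝ}
    (hα0 : 0 < α) (hα1 : α ≤ 1) {r : M → ℝ} (hr0 : ∀ x, 0 ≤ r x) (hr : Integrable r m)
    {ε : ℝ} (hε : 0 < ε) :
    ∃ w : M → ℝ, Continuous w ∧ (∃ δ K : ℝ, 0 < δ ∧ ∀ x, δ ≤ w x ∧ w x ≤ K) ∧
      ∫ x, rpowTangent α (w x) (r x) ∂m < ∫ x, r x ^ α ∂m + ε := by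
  have hmeas : ∀ w : M → ℝ, AEStronglyMeasurable w m →
      AEStronglyMeasurable (fun x => rpowTangent α (w x) (r x)) m := by
    intro w hw
    unfold rpowTangent
    have hw' := hw.aemeasurable
    have hr' := hr.1.aemeasurable
    exact ((((hw'.pow_const _).const_mul _).mul hr').add
      ((hw'.pow_const _).const_mul _)).aestronglyMeasurable
  have hA : Tendsto (fun k => ∫ x, rpowTangent α (clampNat k (r x)) (r x) ∂m) atTop
      (𝓝 (∫ x, r x ^ α ∂m)) := by
    refine tendsto_integral_of_dominated_convergence (fun x => 2 + 2 * r x)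
      (fun k => hmeas _ ((continuous_clampNat k).comp_aestronglyMeasurable hr.1))
      ((integrable_const _).add (hr.const_mul 2)) (fun k => ae_of_all _ fun x => ?_)
      (ae_of_all _ fun x => tendsto_rpowTangent_clampNat hα0 (hr0 x))
    rw [Real.norm_of_nonneg (rpowTangent_nonneg hα0.le hα1 (clampNat_pos _ _) (hr0 x))]
    exact rpowTangent_clampNat_le hα0.le hα1 (hr0 x) k
  obtain ⟨k, hk⟩ := (hA.eventually (gt_mem_nhds (lt_add_of_pos_right _ hε))).exists
  obtain ⟨g, hg⟩ := exists_boundedContinuous_tendsto_ae hr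
  have hδ : (0 : ℝ) < 1 / ((k : ℝ) + 1) := by positivity
  have hB : Tendsto (fun j => ∫ x, rpowTangent α (clampNat k (g j x)) (r x) ∂m) atTop
      (𝓝 (∫ x, rpowTangent α (clampNat k (r x)) (r x) ∂m)) := by
    refine tendsto_integral_of_dominated_convergence
      (fun x => (1 / ((k : ℝ) + 1)) ^ (α - 1) * r x + (1 + (k + 1)))
      (fun j => hmeas _
        ((continuous_clampNat k).comp (g j).continuous).measurable.aestronglyMeasurable)
      ((hr.const_mul _).add (integrable_const _)) (fun j => ae_of_all _ fun x => ?_) ?_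
    · rw [Real.norm_of_nonneg (rpowTangent_nonneg hα0.le hα1 (clampNat_pos _ _) (hr0 x))]
      exact rpowTangent_le hα0.le hα1 hδ (clampNat_lower k _) (clampNat_upper k _) (hr0 x)
    · filter_upwards [hg] with x hx
      have h := ((continuous_clampNat k).tendsto (r x)).comp hx
      have hne : clampNat k (r x) ≠ 0 := (clampNat_pos k (r x)).ne'
      exact (((h.rpow_const (Or.inl hne)).const_mul _).mul_const _).add
        ((h.rpow_const (Or.inl hne)).const_mul _)
  obtain ⟨j, hj⟩ := (hB.eventually (gt_mem_nhds hk)).exists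
  exact ⟨fun x => clampNat k (g j x), (continuous_clampNat k).comp (g j).continuous,
    ⟨_, _, hδ, fun x => ⟨clampNat_lower k _, clampNat_upper k _⟩⟩, hj⟩

/-- If `ν n → ν = r m` weakly and the functionals `∫ R n ^ α` of the absolutely continuous parts
converge to `∫ r ^ α`, the midpoint deficits of the densities vanish in `L¹`: by upper
semicontinuity `∫ ((R n + r) / 2) ^ α` cannot exceed `∫ r ^ α` in the limit. -/
theorem tendsto_integral_midDeficit {m ν : Measure M} [IsFiniteMeasure m] [IsFiniteMeasure ν]
    {νs : ℕ → Measure M} [∀ n, IsFiniteMeasure (νs n)] {α : ℝ} (hα0 : 0 < α) (hα1 : α ≤ 1)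
    {r : M → ℝ} {R : ℕ → M → ℝ} (hr : Measurable r) (hR : ∀ n, Measurable (R n))
    (hr0 : ∀ x, 0 ≤ r x) (hR0 : ∀ n x, 0 ≤ R n x) (hri : Integrable r m)
    (hRi : ∀ n, Integrable (R n) m) (hν : ν = m.withDensity fun x => .ofReal (r x))
    (hνs : ∀ n, m.withDensity (fun x => .ofReal (R n x)) ≤ νs n)
    (hweak : ∀ f : M →ᵇ ℝ, Tendsto (fun n => ∫ x, f x ∂(νs n)) atTop (𝓝 (∫ x, f x ∂ν)))
    (hpow : Tendsto (fun n => ∫ x, R n x ^ α ∂m) atTop (𝓝 (∫ x, r x ^ α ∂m))) :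
    Tendsto (fun n => ∫ x, midDeficit α (R n x) (r x) ∂m) atTop (𝓝 0) := by
  have hmid : ∀ n, Integrable (fun x => ((R n x + r x) / 2) ^ α) m := fun n =>
    integrable_rpow_of_le_one hα0.le hα1 (fun x => by have := hr0 x; have := hR0 n x; positivity)
      (((hRi n).add hri).div_const 2)
  have hrp := integrable_rpow_of_le_one hα0.le hα1 hr0 hri
  have hRp := fun n => integrable_rpow_of_le_one hα0.le hα1 (hR0 n) (hRi n)
  have hsplit : ∀ n, ∫ x, midDeficit α (R n x) (r x) ∂m =
      ∫ x, ((R n x + r x) / 2) ^ α ∂m - (∫ x, R n x ^ α ∂m + ∫ x, r x ^ α ∂m) / 2 := by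
    intro n
    have hs : Integrable (fun x => (R n x ^ α + r x ^ α) / 2) m := ((hRp n).add hrp).div_const 2
    unfold midDeficit
    rw [integral_sub (hmid n) hs, integral_div, integral_add (hRp n) hrp]
  have hnonneg : ∀ n, 0 ≤ ∫ x, midDeficit α (R n x) (r x) ∂m := fun n =>
    integral_nonneg fun x => midDeficit_nonneg hα0.le hα1 (hR0 n x) (hr0 x)
  refine Metric.tendsto_atTop'.2 fun ε hε => ?_
  obtain ⟨w, hwc, ⟨δ, K, hδ, hwδ⟩, hw⟩ :=
    exists_continuous_integral_rpowTangent_lt hα0 hα1 hr0 hri (half_pos hε)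
  have hw0 : ∀ x, 0 < w x := fun x => hδ.trans_le (hwδ x).1
  have hwα : Integrable (fun x => w x ^ α) m := by
    refine integrable_rpow_of_le_one hα0.le hα1 (fun x => (hw0 x).le) ?_
    refine (integrable_const K).mono' hwc.measurable.aestronglyMeasurable (ae_of_all _ fun x => ?_)
    rw [Real.norm_of_nonneg (hw0 x).le]; exact (hwδ x).2
  have hbnn : ∀ x, 0 ≤ w x ^ (α - 1) := fun x => Real.rpow_nonneg (hw0 x).le _
  let b : M →ᵇ ℝ := BoundedContinuousFunction.ofNormedAddCommGroup (fun x => w x ^ (α - 1))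
    (continuous_rpow_of_le hwc hδ (fun x => (hwδ x).1) _) (δ ^ (α - 1)) fun x => by
      rw [Real.norm_of_nonneg (hbnn x)]
      exact rpow_sub_one_le_of_le hα1 hδ (hwδ x).1
  have hb : ∀ x, b x = w x ^ (α - 1) := fun x => rfl
  have hbν : ∀ (κ : Measure M) [IsFiniteMeasure κ], Integrable b κ := fun κ _ => b.integrable κ
  have hbr : ∀ s : M → ℝ, Integrable s m → Integrable (fun x => b x * s x) m := fun s hs =>
    hs.bdd_mul (c := ‖b‖) b.continuous.measurable.aestronglyMeasurable
      (ae_of_all _ fun x => b.norm_coe_le_norm x)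
  have hT : ∀ s : M → ℝ, Integrable s m → ∫ x, rpowTangent α (w x) (s x) ∂m =
      α * ∫ x, b x * s x ∂m + (1 - α) * ∫ x, w x ^ α ∂m := by
    intro s hs
    rw [← integral_const_mul, ← integral_const_mul, ← integral_add ((hbr s hs).const_mul _)
      (hwα.const_mul _)]
    simp only [rpowTangent, hb, mul_assoc]
  have hTi : ∀ s : M → ℝ, Integrable s m → Integrable (fun x => rpowTangent α (w x) (s x)) m := by
    intro s hs
    refine (((hbr s hs).const_mul α).add (hwα.const_mul (1 - α))).congr (ae_of_all _ fun x => ?_)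
    simp [rpowTangent, hb, mul_assoc]
  have hrb : ∫ x, b x ∂ν = ∫ x, b x * r x ∂m := by
    rw [hν, integral_withDensity_eq_integral_toReal_smul hr.ennreal_ofReal
      (ae_of_all _ fun x => ENNReal.ofReal_lt_top)]
    simp [ENNReal.toReal_ofReal (hr0 _), mul_comm]
  have hupper : ∀ n, ∫ x, midDeficit α (R n x) (r x) ∂m ≤
      (α * ∫ x, b x ∂(νs n) + (1 - α) * ∫ x, w x ^ α ∂m
        + ∫ x, rpowTangent α (w x) (r x) ∂m) / 2
        - (∫ x, R n x ^ α ∂m + ∫ x, r x ^ α ∂m) / 2 := by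
    intro n
    rw [hsplit n]
    have h1 : ∫ x, ((R n x + r x) / 2) ^ α ∂m ≤
        ∫ x, (rpowTangent α (w x) (R n x) + rpowTangent α (w x) (r x)) / 2 ∂m := by
      refine integral_mono (hmid n) (((hTi _ (hRi n)).add (hTi _ hri)).div_const 2) fun x => ?_
      refine (rpow_le_tangent hα0.le hα1 (r := (R n x + r x) / 2)
        (by have := hr0 x; have := hR0 n x; positivity) (hw0 x)).trans_eq ?_
      simp only [rpowTangent]; ring
    rw [integral_div, integral_add (hTi _ (hRi n)) (hTi _ hri), hT _ (hRi n)] at h1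
    have h2 := integral_mul_le_integral_of_withDensity_le (f := b) (hR n) (hR0 n) (hνs n) hbnn
      (hbν _)
    have h3 := mul_le_mul_of_nonneg_left h2 hα0.le
    linarith
  have hlim : Tendsto (fun n => (α * ∫ x, b x ∂(νs n) + (1 - α) * ∫ x, w x ^ α ∂m
        + ∫ x, rpowTangent α (w x) (r x) ∂m) / 2
        - (∫ x, R n x ^ α ∂m + ∫ x, r x ^ α ∂m) / 2) atTop
      (𝓝 ((α * ∫ x, b x ∂ν + (1 - α) * ∫ x, w x ^ α ∂m
        + ∫ x, rpowTangent α (w x) (r x) ∂m) / 2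
        - (∫ x, r x ^ α ∂m + ∫ x, r x ^ α ∂m) / 2)) :=
    (((((hweak b).const_mul α).add_const _).add_const _).div_const _).sub
      ((hpow.add_const _).div_const _)
  rw [hrb, ← hT _ hri] at hlim
  obtain ⟨n₀, hn₀⟩ := eventually_atTop.1 (hlim.eventually (gt_mem_nhds (show _ < ε by linarith)))
  refine ⟨n₀, fun n hn => ?_⟩
  rw [Real.dist_eq, sub_zero, abs_of_nonneg (hnonneg n)]
  exact (hupper n).trans_lt (hn₀ n hn.le)

/-- If `ν n → ν = r m` weakly and the functionals `∫ R n ^ α` of the absolutely continuous parts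
converge to `∫ r ^ α`, integrals of bounded *Borel* functions are upper semicontinuous along a
subsequence: the densities converge almost everywhere along it, and Fatou's lemma applies. -/
theorem exists_subseq_limsup_lintegral_le {m ν : Measure M} [IsFiniteMeasure m]
    [IsProbabilityMeasure ν]
    {νs : ℕ → Measure M} [∀ n, IsProbabilityMeasure (νs n)] {α : ℝ} (hα0 : 0 < α) (hα1 : α < 1)
    {r : M → ℝ} {R : ℕ → M → ℝ} (hr : Measurable r) (hR : ∀ n, Measurable (R n))
    (hr0 : ∀ x, 0 ≤ r x) (hR0 : ∀ n x, 0 ≤ R n x) (hri : Integrable r m)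
    (hRi : ∀ n, Integrable (R n) m) (hν : ν = m.withDensity fun x => .ofReal (r x))
    (hνs : ∀ n, m.withDensity (fun x => .ofReal (R n x)) ≤ νs n)
    (hweak : ∀ f : M →ᵇ ℝ, Tendsto (fun n => ∫ x, f x ∂(νs n)) atTop (𝓝 (∫ x, f x ∂ν)))
    (hpow : Tendsto (fun n => ∫ x, R n x ^ α ∂m) atTop (𝓝 (∫ x, r x ^ α ∂m))) :
    ∃ k : ℕ → ℕ, StrictMono k ∧ ∀ (g : M → ℝ≥0∞) (C : ℝ≥0∞), Measurable g → C ≠ ∞ →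
      (∀ x, g x ≤ C) → limsup (fun n => ∫⁻ x, g x ∂(νs (k n))) atTop ≤ ∫⁻ x, g x ∂ν := by
  have hdef := tendsto_integral_midDeficit hα0 hα1.le hr hR hr0 hR0 hri hRi hν hνs hweak hpow
  have hmidm : ∀ n, Measurable fun x => midDeficit α (R n x) (r x) := fun n => by
    unfold midDeficit
    exact ((((hR n).add hr).div_const 2).pow_const α).sub
      ((((hR n).pow_const α).add (hr.pow_const α)).div_const 2)
  have hmidi : ∀ n, Integrable (fun x => midDeficit α (R n x) (r x)) m := fun n =>
    (integrable_rpow_of_le_one hα0.le hα1.le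
      (r := fun x => (R n x + r x) / 2)
      (fun x => by have := hr0 x; have := hR0 n x; positivity)
      (((hRi n).add hri).div_const 2)).sub
    (((integrable_rpow_of_le_one hα0.le hα1.le (hR0 n) (hRi n)).add
      (integrable_rpow_of_le_one hα0.le hα1.le hr0 hri)).div_const 2)
  have hL1 : Tendsto (fun n => eLpNorm ((fun x => midDeficit α (R n x) (r x)) - 0) 1 m) atTop
      (𝓝 0) := by
    have : ∀ n, eLpNorm ((fun x => midDeficit α (R n x) (r x)) - 0) 1 m =
        ENNReal.ofReal (∫ x, midDeficit α (R n x) (r x) ∂m) := by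
      intro n
      rw [sub_zero, eLpNorm_one_eq_lintegral_enorm, ← ofReal_integral_norm_eq_lintegral_enorm
        (hmidi n)]
      congr 1
      exact integral_congr_ae (ae_of_all _ fun x =>
        Real.norm_of_nonneg (midDeficit_nonneg hα0.le hα1.le (hR0 n x) (hr0 x)))
    simp only [this]
    simpa using ENNReal.tendsto_ofReal hdef
  obtain ⟨k, hk, hae⟩ := (tendstoInMeasure_of_tendsto_eLpNorm one_ne_zero
    (fun n => (hmidm n).aestronglyMeasurable) aestronglyMeasurable_const hL1).exists_seq_tendsto_ae
  refine ⟨k, hk, fun g C hg hC hgC => ?_⟩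
  have hconv : ∀ᵐ x ∂m, Tendsto (fun n => R (k n) x) atTop (𝓝 (r x)) := by
    filter_upwards [hae] with x hx
    exact tendsto_of_midDeficit_tendsto_zero hα0 hα1 (fun n => hR0 _ x) (hr0 x) hx
  have hcm : Measurable fun x => C - g x := measurable_const.sub hg
  -- passing to `C - g` turns the claim into a lower bound, to which Fatou's lemma applies
  have hcompl : ∀ (κ : Measure M) [IsProbabilityMeasure κ],
      ∫⁻ x, g x ∂κ = C - ∫⁻ x, (C - g x) ∂κ := by
    intro κ _
    have h1 : ∫⁻ x, (g x + (C - g x)) ∂κ = C := by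
      simp [add_tsub_cancel_of_le (hgC _)]
    rw [lintegral_add_left hg] at h1
    refine ENNReal.eq_sub_of_add_eq (ne_top_of_le_ne_top hC ?_) h1
    calc ∫⁻ x, (C - g x) ∂κ ≤ ∫⁻ x, g x ∂κ + ∫⁻ x, (C - g x) ∂κ := le_add_self
      _ = C := h1
  have hlow : ∫⁻ x, (C - g x) ∂ν ≤ liminf (fun n => ∫⁻ x, (C - g x) ∂(νs (k n))) atTop := by
    calc ∫⁻ x, (C - g x) ∂ν = ∫⁻ x, ENNReal.ofReal (r x) * (C - g x) ∂m := by
          rw [hν, lintegral_withDensity_eq_lintegral_mul _ hr.ennreal_ofReal hcm]; rfl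
      _ = ∫⁻ x, liminf (fun n => ENNReal.ofReal (R (k n) x) * (C - g x)) atTop ∂m := by
          refine lintegral_congr_ae ?_
          filter_upwards [hconv] with x hx
          refine (Tendsto.liminf_eq ?_).symm
          exact ENNReal.Tendsto.mul_const (ENNReal.tendsto_ofReal hx)
            (Or.inr (ne_top_of_le_ne_top hC tsub_le_self))
      _ ≤ liminf (fun n => ∫⁻ x, ENNReal.ofReal (R (k n) x) * (C - g x) ∂m) atTop :=
          lintegral_liminf_le fun n => (hR _).ennreal_ofReal.mul hcm
      _ ≤ liminf (fun n => ∫⁻ x, (C - g x) ∂(νs (k n))) atTop := by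
          refine liminf_le_liminf (Eventually.of_forall fun n => ?_)
          refine le_trans (le_of_eq ?_) (lintegral_mono' (hνs (k n)) le_rfl)
          rw [lintegral_withDensity_eq_lintegral_mul _ (hR _).ennreal_ofReal hcm]; rfl
  calc limsup (fun n => ∫⁻ x, g x ∂(νs (k n))) atTop
      = limsup (fun n => C - ∫⁻ x, (C - g x) ∂(νs (k n))) atTop := by simp only [← hcompl]
    _ = C - liminf (fun n => ∫⁻ x, (C - g x) ∂(νs (k n))) atTop :=
        ENNReal.limsup_const_sub _ _ hC
    _ ≤ C - ∫⁻ x, (C - g x) ∂ν := tsub_le_tsub_left hlow _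
    _ = ∫⁻ x, g x ∂ν := (hcompl ν).symm

end StrongConvergence

/-! ### The power energy -/

theorem powerDensity_eq {N r : ℝ} (hN : 1 < N) (hr : 0 ≤ r) :
    powerDensity N r = N * r - N * r ^ (1 - 1 / N) := by
  have hN0 : 0 < N := by linarith
  have hα : 0 < 1 - 1 / N := by
    rw [sub_pos, div_lt_one hN0]; exact hN
  rcases hr.eq_or_lt with rfl | hr0
  · rw [Real.zero_rpow hα.ne']; simp [powerDensity]
  · have : r ^ (1 - 1 / N) = r * r ^ (-1 / N) := by
      rw [show 1 - 1 / N = 1 + -1 / N by ring, Real.rpow_add hr0, Real.rpow_one]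
    rw [this, powerDensity]; ring

theorem slopeAtInfinity_powerDensity {N : ℝ} (hN : 1 < N) :
    slopeAtInfinity (powerDensity N) = (N : EReal) := by
  have hN0 : 0 < N := by linarith
  refine Tendsto.limsup_eq ?_
  have h1 : Tendsto (fun r : ℝ => r ^ (-1 / N)) atTop (𝓝 0) := by
    rw [neg_div]; exact tendsto_rpow_neg_atTop (by positivity)
  have h2 : Tendsto (fun r : ℝ => N * (1 - r ^ (-1 / N))) atTop (𝓝 N) := by
    simpa using (h1.const_sub 1).const_mul N
  refine (continuous_coe_real_ereal.tendsto N).comp (h2.congr' ?_)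
  filter_upwards [eventually_gt_atTop 0] with r hr
  rw [powerDensity]; field_simp

/-- For a probability measure carried by a set `B` of finite `μ`-measure, the power energy is
finite, and only the integral of `ρ ^ (1 - 1 / N)` varies: the linear part of `U_N` and the
singular part together contribute `N` times the total mass. -/
theorem energyN_eq {M : Type*} [MeasurableSpace M] {μ ν : Measure M} [SigmaFinite μ]
    [IsProbabilityMeasure ν] {N : ℝ} (hN : 1 < N) {B : Set M} (hB : MeasurableSet B)
    (hμB : μ B < ∞) (hνB : ν Bᶜ = 0) :
    energyN N μ ν =
      ((N - N * ∫ x in B, (ν.rnDeriv μ x).toReal ^ (1 - 1 / N) ∂μ : ℝ) : EReal) := by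
  have hN0 : 0 < N := by linarith
  have hα : 0 < 1 - 1 / N := by
    rw [sub_pos, div_lt_one hN0]; exact hN
  have hα1 : 1 - 1 / N ≤ 1 := by
    have : 0 < 1 / N := by positivity
    linarith
  have : IsFiniteMeasure (μ.restrict B) := ⟨by simpa using hμB⟩
  have hρi : Integrable (fun x => (ν.rnDeriv μ x).toReal) μ := Measure.integrable_toReal_rnDeriv
  have hoff : ∀ᵐ x ∂μ, x ∉ B → (ν.rnDeriv μ x).toReal = 0 := by
    have h0 : ∫⁻ x in Bᶜ, ν.rnDeriv μ x ∂μ = 0 :=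
      le_antisymm ((Measure.setLIntegral_rnDeriv_le _).trans hνB.le) zero_le
    rw [lintegral_eq_zero_iff (Measure.measurable_rnDeriv _ _), Filter.EventuallyEq,
      ae_restrict_iff' hB.compl] at h0
    filter_upwards [h0] with x hx hxB
    simp [hx hxB]
  have hpowB : IntegrableOn (fun x => (ν.rnDeriv μ x).toReal ^ (1 - 1 / N)) B μ :=
    integrable_rpow_of_le_one hα.le hα1 (fun _ => ENNReal.toReal_nonneg) hρi.integrableOn
  have hind : B.indicator (fun x => (ν.rnDeriv μ x).toReal ^ (1 - 1 / N)) =ᵐ[μ]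
      fun x => (ν.rnDeriv μ x).toReal ^ (1 - 1 / N) := by
    filter_upwards [hoff] with x hx
    by_cases hxB : x ∈ B
    · simp [hxB]
    · rw [Set.indicator_of_notMem hxB, hx hxB, Real.zero_rpow hα.ne']
  have hpow : Integrable (fun x => (ν.rnDeriv μ x).toReal ^ (1 - 1 / N)) μ :=
    ((integrable_indicator_iff hB).2 hpowB).congr hind
  have hpowint : ∫ x, (ν.rnDeriv μ x).toReal ^ (1 - 1 / N) ∂μ =
      ∫ x in B, (ν.rnDeriv μ x).toReal ^ (1 - 1 / N) ∂μ := by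
    rw [← integral_congr_ae hind, integral_indicator hB]
  have hU : ∀ x, powerDensity N (ν.rnDeriv μ x).toReal =
      N * (ν.rnDeriv μ x).toReal - N * (ν.rnDeriv μ x).toReal ^ (1 - 1 / N) :=
    fun x => powerDensity_eq hN ENNReal.toReal_nonneg
  have hUi : Integrable (fun x => powerDensity N (ν.rnDeriv μ x).toReal) μ := by
    simp only [hU]
    exact (hρi.const_mul N).sub (hpow.const_mul N)
  have hmass : ∫ x, (ν.rnDeriv μ x).toReal ∂μ = 1 - (ν.singularPart μ Set.univ).toReal := by
    have := Measure.integral_toReal_rnDeriv' (μ := ν) (ν := μ)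
    simpa [Measure.real] using this
  have hpos : ∫⁻ x, ENNReal.ofReal (powerDensity N (ν.rnDeriv μ x).toReal) ∂μ ≠ ∞ :=
    hUi.lintegral_lt_top.ne
  have hneg : ∫⁻ x, ENNReal.ofReal (-powerDensity N (ν.rnDeriv μ x).toReal) ∂μ ≠ ∞ :=
    hUi.neg.lintegral_lt_top.ne
  have hint := integral_eq_lintegral_pos_part_sub_lintegral_neg_part hUi
  have hint2 : ∫ x, powerDensity N (ν.rnDeriv μ x).toReal ∂μ =
      N * (1 - (ν.singularPart μ Set.univ).toReal)
        - N * ∫ x in B, (ν.rnDeriv μ x).toReal ^ (1 - 1 / N) ∂μ := by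
    simp only [hU]
    rw [integral_sub (hρi.const_mul N) (hpow.const_mul N), integral_const_mul,
      integral_const_mul, hmass, hpowint]
  have hcoe : ∀ a : ℝ≥0∞, a ≠ ∞ → (a : EReal) = ((a.toReal : ℝ) : EReal) := fun a ha =>
    (EReal.coe_ennreal_toReal ha).symm
  rw [energyN, energy, slopeAtInfinity_powerDensity hN, hcoe _ hpos, hcoe _ hneg,
    hcoe _ (measure_ne_top _ _), ← EReal.coe_sub, ← hint, hint2, ← EReal.coe_mul,
    ← EReal.coe_add]
  congr 1
  ring

/-! ### Kantorovich potentials along optimal plans -/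

section Potential

variable {M : Type*} [MetricSpace M]

/-- `y` belongs to the `c_p`-superdifferential of `φ` at `x`: the function `c_p(·, y) - φ` attains
its minimum at `x`. -/
def MemSuperdiff (p : ℝ) (φ : M → ℝ) (x y : M) : Prop :=
  ∀ z, φ z - φ x ≤ cost p z y - cost p x y

theorem cost_nonneg {p : ℝ} (hp : 0 ≤ p) (x y : M) : 0 ≤ cost p x y :=
  div_nonneg (Real.rpow_nonneg dist_nonneg _) hp

theorem continuous_cost {p : ℝ} (hp : 0 ≤ p) : Continuous fun z : M × M => cost p z.1 z.2 :=
  (continuous_dist.rpow_const fun _ => Or.inr hp).div_const p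

theorem toReal_cTransform_le {p : ℝ} {φ : M → ℝ} {y : M}
    (hb : cTransform p (fun x => (φ x : EReal)) y ≠ ⊥)
    (ht : cTransform p (fun x => (φ x : EReal)) y ≠ ⊤) (x : M) :
    (cTransform p (fun x => (φ x : EReal)) y).toReal ≤ cost p x y - φ x := by
  have h : cTransform p (fun x => (φ x : EReal)) y ≤ ((cost p x y - φ x : ℝ) : EReal) := by
    rw [EReal.coe_sub]; exact iInf_le _ x
  rw [← EReal.coe_toReal ht hb] at h
  exact EReal.coe_le_coe_iff.1 h

/-- The slope of a potential at `x` is controlled by the distance to any point `y` of its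
superdifferential, since
`c_p(z, y) - c_p(x, y) ≤ ((d(x, y) + d(z, x)) ^ p - d(x, y) ^ p) / p`. -/
theorem MemSuperdiff.ascendingSlope_le {p : ℝ} (hp : 1 < p) {φ : M → ℝ} {x y : M}
    (h : MemSuperdiff p φ x y) : ascendingSlope φ x ≤ edist x y ^ (p - 1) := by
  have hp0 : 0 < p := by linarith
  refine le_of_forall_gt_imp_ge_of_dense fun b hb => ?_
  have hlim : Tendsto (fun z => ENNReal.ofReal ((dist x y + dist z x) ^ (p - 1))) (𝓝[≠] x)
      (𝓝 (edist x y ^ (p - 1))) := by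
    have h1 : Tendsto (fun z => ENNReal.ofReal ((dist x y + dist z x) ^ (p - 1))) (𝓝 x)
        (𝓝 (ENNReal.ofReal ((dist x y + dist x x) ^ (p - 1)))) := by
      refine Continuous.tendsto
        (f := fun z => ENNReal.ofReal ((dist x y + dist z x) ^ (p - 1))) ?_ x
      refine ENNReal.continuous_ofReal.comp (Continuous.rpow_const (by fun_prop) fun _ => Or.inr ?_)
      linarith
    rw [dist_self, add_zero, ← ENNReal.ofReal_rpow_of_nonneg dist_nonneg (by linarith),
      ← edist_dist] at h1
    exact h1.mono_left nhdsWithin_le_nhds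
  refine limsup_le_of_le (by isBoundedDefault) ?_
  filter_upwards [hlim.eventually (gt_mem_nhds hb), self_mem_nhdsWithin] with z hz hzx
  refine (ENNReal.div_le_of_le_mul ?_).trans hz.le
  have hpos : 0 < dist z x := dist_pos.2 hzx
  rw [edist_dist, ← ENNReal.ofReal_mul (by positivity)]
  refine ENNReal.ofReal_le_ofReal ((h z).trans ?_)
  have h1 := rpow_sub_rpow_le hp.le (dist_nonneg (x := x) (y := y))
    (add_pos_of_nonneg_of_pos (dist_nonneg (x := x) (y := y)) hpos)
  have h2 : cost p z y ≤ (dist x y + dist z x) ^ p / p := by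
    have := dist_triangle z x y
    unfold cost
    gcongr
    linarith
  have h3 : cost p x y = dist x y ^ p / p := rfl
  rw [add_sub_cancel_left, sub_div] at h1
  linarith

/-- Along a geodesic from `x = γ 0` to a point `γ 1` of the superdifferential at `x`, the potential
drops by at least `t (1 - t) ^ (p - 1) D ^ p`, with `D = d(γ 0, γ 1)`, up to time `t`; seen from `γ t` this drop is an ascent over the
distance `t D`, so it is controlled by the slope of `φ` at `γ t` at a scale larger than `t D`. -/
theorem MemSuperdiff.mul_edist_rpow_le {p : ℝ} (hp : 1 < p) {φ : M → ℝ} {γ : Geo M}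
    (h : MemSuperdiff p φ (γ.eval 0) (γ.eval 1)) {t : unitInterval} (ht0 : 0 < t) (ht1 : t < 1)
    {r : ℝ} (hr : (t : ℝ) * dist (γ.eval 0) (γ.eval 1) < r) :
    ENNReal.ofReal ((1 - t : ℝ) ^ (p - 1)) * edist (γ.eval 0) (γ.eval 1) ^ p ≤
      scaleSlope φ r (γ.eval t) * edist (γ.eval 0) (γ.eval 1) := by
  have hp0 : 0 < p := by linarith
  have ht0' : (0 : ℝ) < t := ht0
  have ht1' : (t : ℝ) < 1 := ht1
  have hd0 : dist (γ.eval 0) (γ.eval t) = t * dist (γ.eval 0) (γ.eval 1) := by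
    have := γ.2 0 t
    simpa [Geo.eval, abs_of_pos ht0'] using this
  have hd1 : dist (γ.eval t) (γ.eval 1) = (1 - t) * dist (γ.eval 0) (γ.eval 1) := by
    have := γ.2 t 1
    simpa [Geo.eval, abs_of_pos (sub_pos.2 ht1')] using this
  set D := dist (γ.eval 0) (γ.eval 1) with hD
  rcases (dist_nonneg : 0 ≤ dist (γ.eval 0) (γ.eval 1)).eq_or_lt with h0 | hDpos
  · have : edist (γ.eval 0) (γ.eval 1) = 0 := by rw [edist_dist, ← h0, ENNReal.ofReal_zero]
    simp [this, hp0]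
  rw [← hD] at hDpos
  have h1t : 0 < 1 - (t : ℝ) := sub_pos.2 ht1'
  have hdrop : (t : ℝ) * ((1 - t) ^ (p - 1) * D ^ p) ≤ φ (γ.eval 0) - φ (γ.eval t) := by
    have h1 := h (γ.eval t)
    have h2 := le_rpow_sub_rpow hp.le (mul_pos h1t hDpos) hDpos.le
    have h3 : cost p (γ.eval 0) (γ.eval 1) - cost p (γ.eval t) (γ.eval 1) =
        (D ^ p - ((1 - t) * D) ^ p) / p := by
      rw [cost, cost, hd1, ← hD]; ring
    have h4 : (D - (1 - t) * D) * ((1 - t) * D) ^ (p - 1) = t * ((1 - t) ^ (p - 1) * D ^ p) := by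
      rw [Real.mul_rpow h1t.le hDpos.le, Real.rpow_sub_one hDpos.ne']
      field_simp; ring
    linarith
  have hs := ofReal_sub_le_scaleSlope_mul (f := φ) (r := r) (x := γ.eval t) (y := γ.eval 0)
    (by rw [hd0]; exact hr)
  have hmain := (ENNReal.ofReal_le_ofReal hdrop).trans hs
  rw [edist_dist (γ.eval 0) (γ.eval t), hd0, ENNReal.ofReal_mul ht0'.le,
    ENNReal.ofReal_mul ht0'.le, ENNReal.ofReal_mul (by positivity), hD,
    ← ENNReal.ofReal_rpow_of_nonneg dist_nonneg hp0.le, ← edist_dist,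
    mul_left_comm (scaleSlope _ _ _)] at hmain
  exact (ENNReal.mul_le_mul_iff_right
    (by rw [Ne, ENNReal.ofReal_eq_zero, not_le]; exact ht0') ENNReal.ofReal_ne_top).1 hmain

theorem continuous_eval_endpoints :
    Continuous fun γ : Geo M => (Geo.eval 0 γ, Geo.eval 1 γ) :=
  (Geo.continuous_eval 0).prodMk (Geo.continuous_eval 1)

theorem transportCost_ne_top_of_isKantorovichPotential [MeasurableSpace M]
    {p : ℝ} {ν₀ ν₁ : Measure M} {φ : M → EReal}
    (hφ : IsKantorovichPotential p ν₀ ν₁ φ) : transportCost p ν₀ ν₁ ≠ ∞ := by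
  intro h
  have := hφ.2.2.2
  rw [h] at this
  exact EReal.coe_ne_top _ this

variable [SecondCountableTopology M] [MeasurableSpace M] [BorelSpace M]

/-- Optimal couplings are concentrated on the superdifferential of a Kantorovich potential: the
nonnegative function `c_p(x, y) - φ x - φ^c y` has integral zero. -/
theorem IsOptimalCoupling.ae_memSuperdiff {p : ℝ} (hp : 0 < p) {ν₀ ν₁ : Measure M} {φ : M → ℝ}
    (hφ : IsKantorovichPotential p ν₀ ν₁ (fun x => (φ x : EReal))) {σ : Measure (M × M)}
    (hσ : IsOptimalCoupling p ν₀ ν₁ σ) : ∀ᵐ z ∂σ, MemSuperdiff p φ z.1 z.2 := by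
  obtain ⟨-, ⟨-, hφi⟩, ⟨hψae, hψi⟩, hval⟩ := hφ
  obtain ⟨⟨rfl, rfl⟩, hopt⟩ := hσ
  simp only [EReal.toReal_coe] at hφi hval
  set ψ : M → ℝ := fun y => (cTransform p (fun x => (φ x : EReal)) y).toReal with hψ
  have hfin := ae_of_ae_map measurable_snd.aemeasurable hψae
  have hφσ : Integrable (fun z => φ z.1) σ := hφi.comp_measurable measurable_fst
  have hψσ : Integrable (fun z => ψ z.2) σ := hψi.comp_measurable measurable_snd
  rw [integral_map measurable_fst.aemeasurable hφi.1,
    integral_map measurable_snd.aemeasurable hψi.1, ← hopt] at hval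
  have hcm := (continuous_cost (M := M) hp.le).measurable
  have hC : planCost p σ ≠ ∞ := by
    intro hcon
    rw [hcon] at hval
    exact EReal.coe_ne_top _ hval
  have hci : Integrable (fun z : M × M => cost p z.1 z.2) σ := by
    refine ⟨hcm.aestronglyMeasurable, ?_⟩
    rw [hasFiniteIntegral_iff_ofReal (ae_of_all _ fun z => cost_nonneg hp.le _ _)]
    exact hC.lt_top
  have hval' : ∫ z, φ z.1 ∂σ + ∫ z, ψ z.2 ∂σ = ∫ z, cost p z.1 z.2 ∂σ := by
    rw [integral_eq_lintegral_of_nonneg_ae (ae_of_all _ fun z => cost_nonneg hp.le _ _)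
      hcm.aestronglyMeasurable]
    have := congrArg EReal.toReal hval
    rwa [EReal.toReal_coe, EReal.toReal_coe_ennreal] at this
  have hnn : 0 ≤ᵐ[σ] fun z => cost p z.1 z.2 - φ z.1 - ψ z.2 := by
    filter_upwards [hfin] with z hz
    have := toReal_cTransform_le hz.2 hz.1 z.1
    simp only [Pi.zero_apply]
    linarith
  have hzero : ∫ z, (cost p z.1 z.2 - φ z.1 - ψ z.2) ∂σ = 0 := by
    have h1 : Integrable (fun z : M × M => cost p z.1 z.2 - φ z.1) σ := hci.sub hφσ
    rw [integral_sub h1 hψσ, integral_sub hci hφσ]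
    linarith
  have := (integral_eq_zero_iff_of_nonneg_ae hnn ((hci.sub hφσ).sub hψσ)).1 hzero
  filter_upwards [this, hfin] with z hz hz2 w
  have h1 := toReal_cTransform_le hz2.2 hz2.1 w
  simp only [Pi.zero_apply] at hz
  linarith

variable {p : ℝ} {ν₀ ν₁ : Measure M} {Q : Measure (Geo M)}

theorem map_eval_zero_of_mem_optGeo (hQ : Q ∈ OptGeo p ν₀ ν₁) : Q.map (Geo.eval 0) = ν₀ := by
  rw [← hQ.2.1.1, Measure.map_map measurable_fst continuous_eval_endpoints.measurable]
  rfl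

theorem ae_memSuperdiff_of_mem_optGeo (hp : 0 < p) {φ : M → ℝ}
    (hφ : IsKantorovichPotential p ν₀ ν₁ (fun x => (φ x : EReal))) (hQ : Q ∈ OptGeo p ν₀ ν₁) :
    ∀ᵐ γ ∂Q, MemSuperdiff p φ (Geo.eval 0 γ) (Geo.eval 1 γ) :=
  ae_of_ae_map continuous_eval_endpoints.measurable.aemeasurable (hQ.2.ae_memSuperdiff hp hφ)

theorem lintegral_edist_rpow_of_mem_optGeo (hp : 0 < p) (hQ : Q ∈ OptGeo p ν₀ ν₁) :
    ∫⁻ γ, edist (Geo.eval 0 γ) (Geo.eval 1 γ) ^ p ∂Q =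
      ENNReal.ofReal p * transportCost p ν₀ ν₁ := by
  have hcm := (continuous_cost (M := M) hp.le).measurable.ennreal_ofReal
  rw [← hQ.2.2, planCost, lintegral_map hcm continuous_eval_endpoints.measurable,
    ← lintegral_const_mul' _ _ ENNReal.ofReal_ne_top]
  refine lintegral_congr fun γ => ?_
  rw [← ENNReal.ofReal_mul hp.le, cost, mul_div_cancel₀ _ hp.ne',
    ← ENNReal.ofReal_rpow_of_nonneg dist_nonneg hp.le, edist_dist]

end Potential

/-! ### The lower bound for the slope -/

section LowerBound

variable {M : Type*} [MetricSpace M] [SecondCountableTopology M] [MeasurableSpace M] [BorelSpace M]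

/-- If the energies of the interpolations `μ_t` converge to the one of `μ_0`, there is a sequence of
times `t → 0` along which integrals of bounded Borel functions are upper semicontinuous. -/
theorem exists_times_limsup_lintegral_le {μ : Measure M} [SigmaFinite μ] {N : ℝ} (hN : 1 < N)
    {B : Set M} (hB : MeasurableSet B) (hμB : μ B < ∞) {Q : Measure (Geo M)}
    [IsProbabilityMeasure Q] (hac : Q.map (Geo.eval 0) ≪ μ)
    (hlim : Tendsto (fun t : unitInterval => energyN N μ (Q.map (Geo.eval t))) (𝓝[>] 0)
      (𝓝 (energyN N μ (Q.map (Geo.eval 0)))))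
    (hQB : ∀ t : unitInterval, Q.map (Geo.eval t) Bᶜ = 0) :
    ∃ t : ℕ → unitInterval, (∀ n, 0 < t n) ∧ (∀ n, t n < 1) ∧ Tendsto t atTop (𝓝 0) ∧
      ∀ (g : M → ℝ≥0∞) (C : ℝ≥0∞), Measurable g → C ≠ ∞ → (∀ x, g x ≤ C) →
        limsup (fun n => ∫⁻ x, g x ∂(Q.map (Geo.eval (t n)))) atTop ≤
          ∫⁻ x, g x ∂(Q.map (Geo.eval 0)) := by
  have hN0 : 0 < N := by linarith
  have hα0 : 0 < 1 - 1 / N := by rw [sub_pos, div_lt_one hN0]; exact hN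
  have hα1 : 1 - 1 / N < 1 := by
    have : 0 < 1 / N := by positivity
    linarith
  have hprob : ∀ t : unitInterval, IsProbabilityMeasure (Q.map (Geo.eval t)) := fun t =>
    Measure.isProbabilityMeasure_map (Geo.continuous_eval t).measurable.aemeasurable
  have : IsFiniteMeasure (μ.restrict B) := ⟨by simpa using hμB⟩
  let t : ℕ → unitInterval := fun n => ⟨1 / ((n : ℝ) + 2), by positivity, by
    rw [div_le_one (by positivity)]; linarith [(Nat.cast_nonneg n : (0 : ℝ) ≤ n)]⟩
  have ht0 : ∀ n, 0 < t n := fun n => Subtype.coe_lt_coe.1 (by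
    show (0 : ℝ) < 1 / ((n : ℝ) + 2); positivity)
  have ht1 : ∀ n, t n < 1 := fun n => Subtype.coe_lt_coe.1 (by
    show 1 / ((n : ℝ) + 2) < (1 : ℝ)
    rw [div_lt_one (by positivity)]; linarith [(Nat.cast_nonneg n : (0 : ℝ) ≤ n)])
  have htlim : Tendsto t atTop (𝓝 0) := by
    refine tendsto_subtype_rng.2 ?_
    show Tendsto (fun n : ℕ => 1 / ((n : ℝ) + 2)) atTop (𝓝 0)
    have h := (tendsto_add_atTop_iff_nat 1).2
      (tendsto_one_div_add_atTop_nhds_zero_nat (𝕜 := ℝ))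
    refine h.congr fun n => ?_
    push_cast; ring
  have htlim' : Tendsto t atTop (𝓝[>] 0) :=
    tendsto_nhdsWithin_iff.2 ⟨htlim, Eventually.of_forall ht0⟩
  have hEn := hlim.comp htlim'
  simp only [Function.comp_def, energyN_eq hN hB hμB (hQB _), EReal.tendsto_coe] at hEn
  have hpow : Tendsto (fun n => ∫ x in B,
      ((Q.map (Geo.eval (t n))).rnDeriv μ x).toReal ^ (1 - 1 / N) ∂μ) atTop
      (𝓝 (∫ x in B, ((Q.map (Geo.eval 0)).rnDeriv μ x).toReal ^ (1 - 1 / N) ∂μ)) := by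
    have h := (hEn.const_sub N).const_mul N⁻¹
    simpa [hN0.ne'] using h
  have hdens : ∀ s : unitInterval, (μ.restrict B).withDensity
      (fun x => .ofReal ((Q.map (Geo.eval s)).rnDeriv μ x).toReal) =
      (μ.withDensity ((Q.map (Geo.eval s)).rnDeriv μ)).restrict B := by
    intro s
    rw [restrict_withDensity hB]
    refine withDensity_congr_ae (ae_restrict_of_ae ?_)
    filter_upwards [Measure.rnDeriv_lt_top (Q.map (Geo.eval s)) μ] with x hx
    exact ENNReal.ofReal_toReal hx.ne
  have hmeas : ∀ s : unitInterval, Measurable fun x =>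
      ((Q.map (Geo.eval s)).rnDeriv μ x).toReal := fun s =>
    (Measure.measurable_rnDeriv _ _).ennreal_toReal
  have hint : ∀ s : unitInterval, Integrable (fun x =>
      ((Q.map (Geo.eval s)).rnDeriv μ x).toReal) (μ.restrict B) := fun s =>
    Measure.integrable_toReal_rnDeriv.integrableOn
  obtain ⟨k, hk, hlimsup⟩ := exists_subseq_limsup_lintegral_le (m := μ.restrict B)
    (ν := Q.map (Geo.eval 0)) (νs := fun n => Q.map (Geo.eval (t n))) hα0 hα1 (hmeas 0)
    (fun n => hmeas (t n)) (fun _ => ENNReal.toReal_nonneg) (fun _ _ => ENNReal.toReal_nonneg)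
    (hint 0) (fun n => hint (t n))
    (by
      rw [hdens, Measure.withDensity_rnDeriv_eq _ _ hac]
      exact (Measure.restrict_eq_self_of_ae_mem (mem_ae_iff.2 (hQB 0))).symm)
    (fun n => by
      rw [hdens]
      exact Measure.restrict_le_self.trans (Measure.withDensity_rnDeriv_le _ _))
    (fun f => by
      have hf : ∀ s : unitInterval, ∫ x, f x ∂(Q.map (Geo.eval s)) =
          ∫ γ, f (Geo.eval s γ) ∂Q := fun s =>
        integral_map (Geo.continuous_eval s).measurable.aemeasurable
          f.continuous.measurable.aestronglyMeasurable
      simp only [hf]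
      refine tendsto_integral_of_dominated_convergence (fun _ => ‖f‖)
        (fun n => (f.continuous.comp (Geo.continuous_eval _)).measurable.aestronglyMeasurable)
        (integrable_const _) (fun n => ae_of_all _ fun γ => f.norm_coe_le_norm _)
        (ae_of_all _ fun γ => ?_)
      exact ((f.continuous.comp γ.1.continuous).tendsto 0).comp htlim)
    hpow
  exact ⟨fun n => t (k n), fun n => ht0 _, fun n => ht1 _, htlim.comp hk.tendsto_atTop, hlimsup⟩

/-- The transport cost is at most the integral of the power of the slope, for a plan with energies
continuous at time zero. Hölder's inequality is applied to the estimate along geodesics at a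
fixed scale; first the time and then the scale tends to zero. -/
theorem lintegral_edist_rpow_le_lintegral_ascendingSlope {μ : Measure M} [SigmaFinite μ]
    {p q : ℝ} (hpq : p.HolderConjugate q) {N : ℝ} (hN : 1 < N)
    {B : Set M} (hB : MeasurableSet B) (hBbdd : Bornology.IsBounded B) (hμB : μ B < ∞)
    {Q : Measure (Geo M)} [IsProbabilityMeasure Q] (hac : Q.map (Geo.eval 0) ≪ μ)
    (hlim : Tendsto (fun t : unitInterval => energyN N μ (Q.map (Geo.eval t))) (𝓝[>] 0)
      (𝓝 (energyN N μ (Q.map (Geo.eval 0)))))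
    (hQB : ∀ t : unitInterval, Q.map (Geo.eval t) Bᶜ = 0) {φ : M → ℝ} (hφc : Continuous φ)
    {K : ℝ≥0} (hK : LipschitzOnWith K φ (Metric.thickening 1 B))
    (hcontact : ∀ᵐ γ ∂Q, MemSuperdiff p φ (Geo.eval 0 γ) (Geo.eval 1 γ)) :
    ∫⁻ γ, edist (Geo.eval 0 γ) (Geo.eval 1 γ) ^ p ∂Q ≤
      ∫⁻ x, ascendingSlope φ x ^ q ∂(Q.map (Geo.eval 0)) := by
  have hp := hpq.lt
  have hp0 := hpq.pos
  have hq0 := hpq.symm.pos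
  have hB' : ∀ t : unitInterval, ∀ᵐ γ ∂Q, Geo.eval t γ ∈ B := fun t =>
    ae_of_ae_map (Geo.continuous_eval t).measurable.aemeasurable (mem_ae_iff.2 (hQB t))
  have hD : ∀ᵐ γ ∂Q, dist (Geo.eval 0 γ) (Geo.eval 1 γ) ≤ Metric.diam B := by
    filter_upwards [hB' 0, hB' 1] with γ h0 h1
    exact Metric.dist_le_diam_of_mem hBbdd h0 h1
  set E := ∫⁻ γ, edist (Geo.eval 0 γ) (Geo.eval 1 γ) ^ p ∂Q with hE
  have hEtop : E ≠ ∞ := by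
    have h1 : E ≤ ∫⁻ _, ENNReal.ofReal (Metric.diam B) ^ p ∂Q := by
      refine lintegral_mono_ae ?_
      filter_upwards [hD] with γ hγ
      rw [edist_dist]
      gcongr
    refine ne_top_of_le_ne_top ?_ h1
    simpa using ENNReal.rpow_ne_top_of_nonneg hp0.le ENNReal.ofReal_ne_top
  rcases eq_or_ne E 0 with hE0 | hE0
  · rw [hE0]; exact zero_le
  obtain ⟨t, ht0, ht1, htlim, hlimsup⟩ :=
    exists_times_limsup_lintegral_le hN hB hμB hac hlim hQB
  let L : ℕ → M → ℝ≥0∞ := fun j => scaleSlope φ (1 / ((j : ℝ) + 1))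
  have hLm : ∀ j, Measurable (L j) := fun j =>
    (lowerSemicontinuous_scaleSlope hφc _).measurable
  have hLK : ∀ j, ∀ x ∈ B, L j x ≤ K := fun j x hx => by
    refine scaleSlope_le_of_lipschitzOnWith hK (by positivity) ?_
    refine (Metric.ball_subset_ball ?_).trans (Metric.ball_subset_thickening hx 1)
    rw [div_le_one (by positivity)]; linarith [(Nat.cast_nonneg j : (0 : ℝ) ≤ j)]
  -- on `B`, which carries all the measures involved, the truncation is inactive
  let g : ℕ → M → ℝ≥0∞ := fun j x => min (L j x ^ q) ((K : ℝ≥0∞) ^ q)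
  have hgm : ∀ j, Measurable (g j) := fun j => ((hLm j).pow_const q).min measurable_const
  have hCtop : (K : ℝ≥0∞) ^ q ≠ ∞ := ENNReal.rpow_ne_top_of_nonneg hq0.le ENNReal.coe_ne_top
  -- Hölder's inequality at time `t n`, divided by `E ^ (1 / p)` and raised to the power `q`
  have hstep : ∀ j, ∀ᶠ n in atTop, ENNReal.ofReal ((1 - t n : ℝ) ^ (p - 1)) ^ q * E ≤
      ∫⁻ x, g j x ∂(Q.map (Geo.eval (t n))) := by
    intro j
    have hsmall : ∀ᶠ n in atTop, (t n : ℝ) * Metric.diam B < 1 / ((j : ℝ) + 1) := by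
      have h1 : Tendsto (fun n => (t n : ℝ) * Metric.diam B) atTop (𝓝 (0 * Metric.diam B)) :=
        ((continuous_subtype_val.tendsto (0 : unitInterval)).comp htlim).mul_const _
      rw [zero_mul] at h1
      exact h1.eventually (gt_mem_nhds (by positivity))
    filter_upwards [hsmall] with n hn
    set c := ENNReal.ofReal ((1 - t n : ℝ) ^ (p - 1)) with hc
    have hcurve : c * E ≤ ∫⁻ γ, edist (Geo.eval 0 γ) (Geo.eval 1 γ) *
        L j (Geo.eval (t n) γ) ∂Q := by
      rw [hE, ← lintegral_const_mul' _ _ ENNReal.ofReal_ne_top]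
      refine lintegral_mono_ae ?_
      filter_upwards [hcontact, hD] with γ hγ hγD
      rw [mul_comm (edist _ _)]
      refine hγ.mul_edist_rpow_le hp (ht0 n) (ht1 n) (lt_of_le_of_lt ?_ hn)
      exact mul_le_mul_of_nonneg_left hγD (t n).2.1
    have hed : Measurable fun γ : Geo M => edist (Geo.eval 0 γ) (Geo.eval 1 γ) :=
      ((Geo.continuous_eval 0).edist (Geo.continuous_eval 1)).measurable
    have hLe : Measurable fun γ : Geo M => L j (Geo.eval (t n) γ) :=
      (hLm j).comp (Geo.continuous_eval (t n)).measurable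
    have hhol := hcurve.trans (ENNReal.lintegral_mul_le_Lp_mul_Lq Q hpq hed.aemeasurable
      hLe.aemeasurable)
    have hG : ∫⁻ γ, L j (Geo.eval (t n) γ) ^ q ∂Q = ∫⁻ x, g j x ∂(Q.map (Geo.eval (t n))) := by
      rw [lintegral_map (hgm j) (Geo.continuous_eval (t n)).measurable]
      refine lintegral_congr_ae ?_
      filter_upwards [hB' (t n)] with γ hγ
      exact (min_eq_left (ENNReal.rpow_le_rpow (hLK j _ hγ) hq0.le)).symm
    rw [hG, ← hE] at hhol
    have hsplit : E = E ^ (1 / p) * E ^ (1 / q) := by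
      rw [← ENNReal.rpow_add _ _ hE0 hEtop, one_div, one_div, hpq.inv_add_inv_eq_one,
        ENNReal.rpow_one]
    have hEp0 : E ^ (1 / p) ≠ 0 := by
      simp [ENNReal.rpow_eq_zero_iff, hE0, hEtop]
    have hEpt : E ^ (1 / p) ≠ ∞ := ENNReal.rpow_ne_top_of_nonneg (by positivity) hEtop
    have h1 : c * E ^ (1 / q) ≤ (∫⁻ x, g j x ∂(Q.map (Geo.eval (t n)))) ^ (1 / q) := by
      nth_rewrite 1 [hsplit] at hhol
      rw [mul_left_comm] at hhol
      exact (ENNReal.mul_le_mul_iff_right hEp0 hEpt).1 hhol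
    have h2 := ENNReal.rpow_le_rpow h1 hq0.le
    rwa [ENNReal.mul_rpow_of_nonneg _ _ hq0.le, ← ENNReal.rpow_mul, ← ENNReal.rpow_mul,
      one_div_mul_cancel hq0.ne', ENNReal.rpow_one, ENNReal.rpow_one] at h2
  have hj : ∀ j, E ≤ ∫⁻ x, g j x ∂(Q.map (Geo.eval 0)) := by
    intro j
    have hlimE : Tendsto (fun n => ENNReal.ofReal ((1 - t n : ℝ) ^ (p - 1)) ^ q * E) atTop
        (𝓝 E) := by
      have h1 : Tendsto (fun n => (1 - (t n : ℝ)) ^ (p - 1)) atTop (𝓝 ((1 - 0) ^ (p - 1))) :=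
        (((continuous_subtype_val.tendsto (0 : unitInterval)).comp htlim).const_sub 1).rpow_const
          (Or.inl (by norm_num))
      rw [sub_zero, Real.one_rpow] at h1
      have h2 := ((ENNReal.continuous_rpow_const (y := q)).tendsto _).comp
        (ENNReal.tendsto_ofReal h1)
      rw [ENNReal.ofReal_one, ENNReal.one_rpow] at h2
      simpa using ENNReal.Tendsto.mul_const h2 (Or.inr hEtop)
    rw [← hlimE.limsup_eq]
    exact (limsup_le_limsup (hstep j)).trans
      (hlimsup (g j) _ (hgm j) hCtop fun x => min_le_right _ _)
  have hprob : IsProbabilityMeasure (Q.map (Geo.eval 0)) :=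
    Measure.isProbabilityMeasure_map (Geo.continuous_eval 0).measurable.aemeasurable
  have hanti : Antitone g := fun i j hij x => by
    refine min_le_min_right _ (ENNReal.rpow_le_rpow (scaleSlope_mono _ ?_ x) hq0.le)
    gcongr
  calc E ≤ ⨅ j, ∫⁻ x, g j x ∂(Q.map (Geo.eval 0)) := le_iInf hj
    _ = ∫⁻ x, ⨅ j, g j x ∂(Q.map (Geo.eval 0)) := by
        refine (lintegral_iInf hgm hanti (ne_top_of_le_ne_top hCtop ?_)).symm
        exact (lintegral_mono fun x => min_le_right _ _).trans (by simp)
    _ ≤ ∫⁻ x, ascendingSlope φ x ^ q ∂(Q.map (Geo.eval 0)) := by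
        refine lintegral_mono fun x => ?_
        have h := (ENNReal.orderIsoRpow q hq0).map_iInf fun j => L j x
        simp only [ENNReal.orderIsoRpow_apply] at h
        rw [ascendingSlope_eq_iInf_scaleSlope]
        exact (iInf_mono fun j => min_le_left _ _).trans h.ge

end LowerBound

end MetricBrenier

end

theorem mainTheorem7 {M : Type*} [MetricSpace M] [SecondCountableTopology M]
    [MeasurableSpace M] [BorelSpace M] (μ : Measure M) [IsLocallyFiniteMeasure μ]
    (p q : ℝ) (hpq : p.HolderConjugate q) (N : ℝ) (hN : 1 < N)
    (B : Set M) (hBclosed : IsClosed B) (hBbdd : Bornology.IsBounded B) (hμB : μ B < ∞)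
    (μ₀ μ₁ : Measure M) [IsProbabilityMeasure μ₀] [IsProbabilityMeasure μ₁]
    (hμ₀ : MetricBrenier.FiniteMoment p μ₀) (hμ₁ : MetricBrenier.FiniteMoment p μ₁)
    (hac : μ₀ ≪ μ)
    (hplan : ∃ Q ∈ MetricBrenier.OptGeo p μ₀ μ₁,
      Tendsto (fun t : unitInterval =>
          MetricBrenier.energyN N μ (Q.map (MetricBrenier.Geo.eval t)))
        (𝓝[>] 0) (𝓝 (MetricBrenier.energyN N μ μ₀)) ∧
      ∀ t : unitInterval, (Q.map (MetricBrenier.Geo.eval t)).support ⊆ B)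
    (φ : M → ℝ)
    (hφ : MetricBrenier.IsKantorovichPotential p μ₀ μ₁ (fun x => (φ x : EReal)))
    (hLip : ∀ S : Set M, Bornology.IsBounded S → ∃ K : ℝ≥0, LipschitzOnWith K φ S) :
    ∀ Q ∈ MetricBrenier.OptGeo p μ₀ μ₁,
      ∀ᵐ γ ∂Q, edist (MetricBrenier.Geo.eval 0 γ) (MetricBrenier.Geo.eval 1 γ) ^ p =
        MetricBrenier.ascendingSlope φ (MetricBrenier.Geo.eval 0 γ) ^ q := by
  open MetricBrenier in
  obtain ⟨Q₀, hQ₀, hlim, hsupp⟩ := hplan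
  have hp0 := hpq.pos
  have hq0 := hpq.symm.pos
  have hφc : Continuous φ := continuous_iff_continuousAt.2 fun x => by
    obtain ⟨K, hK⟩ := hLip (Metric.ball x 1) Metric.isBounded_ball
    exact hK.continuousOn.continuousAt (Metric.ball_mem_nhds x one_pos)
  obtain ⟨K, hK⟩ := hLip (Metric.thickening 1 B) hBbdd.thickening
  have hprob := hQ₀.1
  have hB : ∀ t : unitInterval, Q₀.map (Geo.eval t) Bᶜ = 0 := fun t =>
    measure_mono_null (Set.compl_subset_compl.2 (hsupp t)) Measure.measure_compl_support
  have hzero := map_eval_zero_of_mem_optGeo hQ₀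
  rw [← hzero] at hlim hac
  have hlow := lintegral_edist_rpow_le_lintegral_ascendingSlope hpq hN hBclosed.measurableSet
    hBbdd hμB hac hlim hB hφc hK (ae_memSuperdiff_of_mem_optGeo hp0 hφ hQ₀)
  rw [hzero, lintegral_edist_rpow_of_mem_optGeo hp0 hQ₀] at hlow
  intro Q hQ
  have hsm : Measurable fun x => ascendingSlope φ x ^ q :=
    (measurable_ascendingSlope hφc).pow_const q
  have hle : (fun γ => ascendingSlope φ (Geo.eval 0 γ) ^ q) ≤ᵐ[Q]
      fun γ => edist (Geo.eval 0 γ) (Geo.eval 1 γ) ^ p := by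
    filter_upwards [ae_memSuperdiff_of_mem_optGeo hp0 hφ hQ] with γ hγ
    have h := ENNReal.rpow_le_rpow (hγ.ascendingSlope_le hpq.lt) hq0.le
    rwa [← ENNReal.rpow_mul, hpq.sub_one_mul_conj] at h
  have hE := lintegral_edist_rpow_of_mem_optGeo hp0 hQ
  have hfin : ∫⁻ γ, edist (Geo.eval 0 γ) (Geo.eval 1 γ) ^ p ∂Q ≠ ∞ := by
    rw [hE]
    exact ENNReal.mul_ne_top ENNReal.ofReal_ne_top
      (transportCost_ne_top_of_isKantorovichPotential hφ)
  rw [← hE, ← map_eval_zero_of_mem_optGeo hQ,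
    lintegral_map hsm (Geo.continuous_eval 0).measurable] at hlow
  have hed : Measurable fun γ : Geo M => edist (Geo.eval 0 γ) (Geo.eval 1 γ) ^ p :=
    ((Geo.continuous_eval 0).edist (Geo.continuous_eval 1)).measurable.pow_const p
  filter_upwards [ae_eq_of_ae_le_of_lintegral_le hle
    (ne_top_of_le_ne_top hfin (lintegral_mono_ae hle)) hed.aemeasurable hlow] with γ hγ
  exact hγ.symm
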